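/- **Setting.** Fix an open interval $I\subseteq\mathbb R$. A *weight matrix* of size $N$ on $I$ is a smooth function $W:I\to \mathrm{Mat}_N(\mathbb C)$, positive definite almost everywhere, with finite moments of all orders. It is *reducible* if for some constant nonsingular $M$ the function $MW(x)M^*$ is, up to a permutation of the indices, block diagonal with at least two blocks on all of $I$; otherwise it is *irreducible*. Put $\langle P,Q\rangle_W=\int_I P(x)W(x)Q(x)^*\,dx$ for $P,Q\in \mathrm{Mat}_N(\mathbb C[x])$, and let $(P_n)_{n\ge0}$ be the sequence of monic orthogonal polynomials of $W$. Differential operators $D=\sum_j\partial^jF_j(x)$ with coefficients $F_j\in \mathrm{Mat}_N(\mathbb C[x])$ act on the right, $P\cdot D=\sum_j\partial^j(P)F_j$, and $P\cdot(\mathcal V\mathcal N)=(P\cdot\mathcal V)\cdot\mathcal N$. Let $\mathcal D(W)$ be the set of those $D$ such that for every $n\ge 0$ there is $\Lambda_n\in\mathrm{Mat}_N(\mathbb C)$ with $P_n\cdot D=\Lambda_nP_n$. An operator $\mathcal V$ is *degree-preserving* if $\deg(P\cdot \mathcal V)=\deg P$ for all $P$. A weight $W'$ on $I$, with monic orthogonal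 polynomials $P'_n$, is a *Darboux transformation* of $W$ if some $D\in\mathcal D(W)$ factors as $D=\mathcal V\mathcal N$ with $\mathcal V,\mathcal N$ degree-preserving operators with polynomial coefficients such that for every $n\ge0$ one has $P_n\cdot\mathcal V=A_nP'_n$ for some $A_n\in \mathrm{Mat}_N(\mathbb C)$. Finally $\mathcal V^*$ denotes the formal adjoint: the involution $*$ extends the conjugate transpose of matrix polynomials and sends $\partial$ to $-\partial$. **Theorem.** Let $\alpha,\beta,v\in\mathbb R$ with $|\alpha-\beta|<|v|<\alpha+\beta+2$, and for $x\in(-1,1)$ let $$W(x)=(1-x)^\alpha(1+x)^\beta\Big(W_2\tfrac{(1-x)^2}{4}+W_1\tfrac{1-x}{2}+W_0\Big),\qquad \tilde W(x)=(1-x)^{\alpha+1}(1+x)^{\beta+1}I,$$ $$W_2=\begin{pmatrix}\frac{v(v+2+\alpha+\beta)}{v+\alpha-\beta}&0\\0&\frac{v(-v+2+\alpha+\beta)}{v-\alpha+\beta}\end{pmatrix},\quad W_1=\begin{pmatrix}-(v+\alpha+\beta+2)&\alpha+\beta+2\\ \alpha+\beta+2&-(-v+\alpha+\beta+2)\end{pmatrix},\quad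 W_0=(\alpha+1)\begin{pmatrix}1&-1\\-1&1\end{pmatrix}.$$ Then $W$ and $\tilde W$ are weight matrices on $(-1,1)$, $W$ is irreducible, and $W$ is a Darboux transformation of $\tilde W$. More precisely, put $$\mathcal V=\partial\begin{pmatrix}x+\frac{\beta-\alpha}{v}&1+\frac{\beta-\alpha}{v}\\1+\frac{\alpha-\beta}{v}&x+\frac{\alpha-\beta}{v}\end{pmatrix}+\begin{pmatrix}\frac{v+2+\alpha+\beta}{2}&0\\0&\frac{-v+2+\alpha+\beta}{2}\end{pmatrix},$$ $$\mathcal N_0=\partial\begin{pmatrix}-x+\frac{\beta-\alpha}{v}&1+\frac{\beta-\alpha}{v}\\1+\frac{\alpha-\beta}{v}&-x+\frac{\alpha-\beta}{v}\end{pmatrix}-\begin{pmatrix}\frac{-v+4+\alpha+\beta}{2}&0\\0&\frac{\alpha+\beta+v+4}{2}\end{pmatrix},$$ $$D_0=\partial^2(1-x^2)I+\partial\big(\beta-\alpha-x(\alpha+\beta+4)\big)I-\tfrac14\begin{pmatrix}(-v+4+\alpha+\beta)(v+2+\alpha+\beta)&0\\0&(\alpha+\beta+v+4)(-v+2+\alpha+\beta)\end{pmatrix},$$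 $$S=-\tfrac14W_2,\qquad \mathcal N=\mathcal N_0S,\qquad D=D_0S .$$ Then: 1. $D_0,D\in\mathcal D(\tilde W)$, $D_0=\mathcal V\mathcal N_0$ and $D=\mathcal V\mathcal N$; 2. $\mathcal N=W\mathcal V^*\tilde W^{-1}$ on $(-1,1)$; 3. $\mathcal V$, $\mathcal N_0$ and $\mathcal N$ are degree-preserving; 4. $\langle P\cdot\mathcal V,Q\rangle_W=\langle P,Q\cdot\mathcal N\rangle_{\tilde W}$ for all $P,Q\in \mathrm{Mat}_2(\mathbb C[x])$; 5. if $\tilde P_n$ and $P_n$ are the monic orthogonal polynomials of $\tilde W$ and $W$, then for every $n\ge 0$ one has $\tilde P_n\cdot\mathcal V=A_nP_n$ with $A_n\in\mathrm{Mat}_2(\mathbb C)$ invertible. -/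

import Mathlib

open Polynomial MeasureTheory
open scoped Matrix ComplexOrder ContDiff

noncomputable section

namespace MatrixDarboux

/-- Complex `N × N` matrices. -/
abbrev CMat (N : ℕ) : Type := Matrix (Fin N) (Fin N) ℂ

/-- Matrix polynomials in one variable, written with matrix coefficients (the semiring structure on
the coefficients is taken from their ring structure, so that negation is found easily). -/
abbrev MatPoly (N : ℕ) : Type := @Polynomial (CMat N) Ring.toSemiring

/-- The value of a matrix polynomial at a real point. -/
def evalAt {N : ℕ} (P : MatPoly N) (x : ℝ) : CMat N :=
  P.eval (algebraMap ℂ (CMat N) (x : ℂ))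

/-- `W` is a weight matrix on the interval `I`: `I` is a non-empty open interval, `W` is smooth
on `I`, positive definite almost everywhere on `I`, and has finite moments of all orders. -/
structure IsWeight {N : ℕ} (I : Set ℝ) (W : ℝ → CMat N) : Prop where
  isOpen : IsOpen I
  ordConnected : I.OrdConnected
  nonempty : I.Nonempty
  smooth : ∀ i j, ContDiffOn ℝ ∞ (fun x => W x i j) I
  posDef : ∀ᵐ x ∂(volume.restrict I), (W x).PosDef
  moments : ∀ (n : ℕ) (i j : Fin N), IntegrableOn (fun x : ℝ => (x : ℂ) ^ n * W x i j) I volume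

/-- `W` is reducible: for some constant nonsingular `M`, the weight `M W(x) Mᴴ` splits as a direct
sum of two smaller blocks, indexed by `S` and its complement. -/
def IsReducible {N : ℕ} (I : Set ℝ) (W : ℝ → CMat N) : Prop :=
  ∃ M : CMat N, IsUnit M ∧ ∃ S : Set (Fin N), S.Nonempty ∧ Sᶜ.Nonempty ∧
    ∀ x ∈ I, ∀ i ∈ S, ∀ j ∈ Sᶜ, (M * W x * Mᴴ) i j = 0 ∧ (M * W x * Mᴴ) j i = 0

/-- The matrix-valued form `⟨P, Q⟩_W = ∫_I P(x) W(x) Q(x)ᴴ dx`, entry by entry. -/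
def form {N : ℕ} (I : Set ℝ) (W : ℝ → CMat N) (P Q : MatPoly N) : CMat N :=
  Matrix.of fun i j => ∫ x in I, (evalAt P x * W x * (evalAt Q x)ᴴ) i j

/-- `P` is a sequence of monic orthogonal polynomials with respect to `W`. -/
def IsMonicOPS {N : ℕ} (I : Set ℝ) (W : ℝ → CMat N) (P : ℕ → MatPoly N) : Prop :=
  (∀ n, (P n).natDegree = n ∧ (P n).Monic) ∧ ∀ n m, n ≠ m → form I W (P n) (P m) = 0

/-- Matrix differential operators `∑ j, ∂^j F_j(x)` with polynomial coefficients `F_j`;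
the function `j ↦ F_j` is finitely supported. -/
abbrev DiffOp (N : ℕ) : Type := ℕ →₀ MatPoly N

/-- The right action `P · D = ∑ j, ∂^j(P) F_j`. -/
def act {N : ℕ} (P : MatPoly N) (D : DiffOp N) : MatPoly N :=
  D.sum fun j F => derivative^[j] P * F

/-- The product `V E` of operators acting on the right (first `V`, then `E`), by the Leibniz rule
`(∂^i F)(∂^j G) = ∑ k ≤ j, binom(j, k) ∂^(i+k) F^(j-k) G`. -/
def opComp {N : ℕ} (V E : DiffOp N) : DiffOp N :=
  V.sum fun i F => E.sum fun j G => ∑ k ∈ Finset.range (j + 1),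
    Finsupp.single (i + k) (j.choose k • (derivative^[j - k] F * G))

theorem act_add {N : ℕ} (P : MatPoly N) (D E : DiffOp N) : act P (D + E) = act P D + act P E :=
  Finsupp.sum_add_index' (fun _ => mul_zero _) (fun _ _ _ => mul_add _ _ _)

theorem act_single {N : ℕ} (P : MatPoly N) (j : ℕ) (F : MatPoly N) :
    act P (Finsupp.single j F) = derivative^[j] P * F :=
  Finsupp.sum_single_index (mul_zero _)

theorem act_sum {N : ℕ} {ι : Type} (P : MatPoly N) (s : Finset ι) (f : ι → DiffOp N) :
    act P (∑ i ∈ s, f i) = ∑ i ∈ s, act P (f i) :=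
  map_sum (⟨⟨act P, Finsupp.sum_zero_index⟩, act_add P⟩ : DiffOp N →+ MatPoly N) f s

/-- The product of operators is composition of the right actions. -/
theorem act_opComp {N : ℕ} (P : MatPoly N) (V E : DiffOp N) :
    act P (opComp V E) = act (act P V) E := by
  unfold opComp
  rw [Finsupp.sum, act_sum]
  conv_rhs => unfold act
  simp only [Finsupp.sum, iterate_derivative_sum, Finset.sum_mul]
  simp only [act_sum]
  rw [Finset.sum_comm]
  refine Finset.sum_congr rfl fun j _ => Finset.sum_congr rfl fun i _ => ?_
  rw [iterate_derivative_mul, Finset.sum_mul, ← Finset.sum_range_reflect]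
  refine Finset.sum_congr rfl fun k hk => ?_
  have hk' : k ≤ j := Nat.lt_succ_iff.mp (Finset.mem_range.mp hk)
  have h1 : j + 1 - 1 - k = j - k := by omega
  have h2 : j - (j - k) = k := by omega
  rw [act_single, h1, h2, Nat.choose_symm hk', ← Function.iterate_add_apply,
    Nat.add_comm i (j - k), mul_smul_comm, smul_mul_assoc, mul_assoc]

/-- `D` belongs to the algebra `𝒟(W)`: the monic orthogonal polynomials of `W` are eigenfunctions
of `D`, with matrix eigenvalues acting on the left. -/
def MemAlg {N : ℕ} (I : Set ℝ) (W : ℝ → CMat N) (D : DiffOp N) : Prop :=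
  ∃ P : ℕ → MatPoly N, IsMonicOPS I W P ∧ ∀ n, ∃ L : CMat N, act (P n) D = C L * P n

/-- `V` is degree-preserving. -/
def DegreePreserving {N : ℕ} (V : DiffOp N) : Prop :=
  ∀ P : MatPoly N, (act P V).degree = P.degree

/-- `W'` is a Darboux transformation of `W`: some `D ∈ 𝒟(W)` factors as `D = V E` with `V`, `E`
degree-preserving, and `V` maps the monic orthogonal polynomials `P n` of `W` to left multiples
of the monic orthogonal polynomials `P' n` of `W'`. -/
def IsDarbouxTransform {N : ℕ} (I : Set ℝ) (W' W : ℝ → CMat N) : Prop :=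
  ∃ P P' : ℕ → MatPoly N, IsMonicOPS I W P ∧ IsMonicOPS I W' P' ∧
    ∃ D V E : DiffOp N, MemAlg I W D ∧ D = opComp V E ∧ DegreePreserving V ∧ DegreePreserving E ∧
      ∀ n, ∃ A : CMat N, act (P n) V = C A * P' n

/-- The coefficient of `∂^k`, at the point `x`, of the operator `W' V* W⁻¹`, where `V*` is the
formal adjoint of `V = ∑ j, ∂^j F_j`. Since `P · (W' V* W⁻¹) = ∑ j, (-1)^j (P W' F_jᴴ)^(j) W⁻¹`,
it is `∑ j ≥ k, (-1)^j binom(j, k) (W' F_jᴴ)^(j-k)(x) W(x)⁻¹`. -/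
def adjointCoeff {N : ℕ} (W' : ℝ → CMat N) (V : DiffOp N) (W : ℝ → CMat N) (k : ℕ) (x : ℝ) :
    CMat N :=
  (∑ j ∈ V.support with k ≤ j, ((-1 : ℂ) ^ j * (j.choose k : ℂ)) •
    (Matrix.of fun a b =>
      iteratedDeriv (j - k) (fun y : ℝ => (W' y * (evalAt (V j) y)ᴴ) a b) x : CMat N)) * (W x)⁻¹

/-- The identity `E = W' V* W⁻¹` of differential operators on the interval `I`. -/
def IsFormalAdjoint {N : ℕ} (I : Set ℝ) (E : DiffOp N) (W' : ℝ → CMat N) (V : DiffOp N)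
    (W : ℝ → CMat N) : Prop :=
  ∀ k, ∀ x ∈ I, evalAt (E k) x = adjointCoeff W' V W k x

section Jacobi

/-- The interval `(-1, 1)`. -/
def jacI : Set ℝ := Set.Ioo (-1) 1

/-- A real `2 × 2` matrix, seen as a complex one. -/
def cmat (M : Matrix (Fin 2) (Fin 2) ℝ) : CMat 2 := M.map (fun t : ℝ => (t : ℂ))

variable (α β v : ℝ)

/-- The coefficient `W₂`. -/
def jacW2 : Matrix (Fin 2) (Fin 2) ℝ :=
  !![v * (v + 2 + α + β) / (v + α - β), 0; 0, v * (-v + 2 + α + β) / (v - α + β)]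

/-- The coefficient `W₁`. -/
def jacW1 : Matrix (Fin 2) (Fin 2) ℝ :=
  !![-(v + α + β + 2), α + β + 2; α + β + 2, -(-v + α + β + 2)]

/-- The coefficient `W₀`. -/
def jacW0 : Matrix (Fin 2) (Fin 2) ℝ :=
  !![α + 1, -α - 1; -α - 1, α + 1]

/-- The Jacobi-type weight `W(x)`. -/
def jacW (x : ℝ) : CMat 2 :=
  cmat (((1 - x) ^ α * (1 + x) ^ β) •
    (((1 - x) ^ 2 / 4) • jacW2 α β v + ((1 - x) / 2) • jacW1 α β v + jacW0 α))

/-- The diagonal weight `(1-x)^(α+1) (1+x)^(β+1) I`. -/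
def jacDiag (x : ℝ) : CMat 2 :=
  cmat (((1 - x) ^ (α + 1) * (1 + x) ^ (β + 1)) • (1 : Matrix (Fin 2) (Fin 2) ℝ))

/-- The first-order operator `𝒱`. -/
def jacV : DiffOp 2 :=
  Finsupp.single 1 (X + C (cmat !![(β - α) / v, 1 + (β - α) / v; 1 + (α - β) / v, (α - β) / v])) +
  Finsupp.single 0 (C (cmat !![(v + 2 + α + β) / 2, 0; 0, (-v + 2 + α + β) / 2]))

/-- The first-order operator `𝒩₀`. -/
def jacN0 : DiffOp 2 :=
  Finsupp.single 1 (-X + C (cmat !![(β - α) / v, 1 + (β - α) / v; 1 + (α - β) / v, (α - β) / v])) +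
  Finsupp.single 0 (C (cmat !![-(-v + 4 + α + β) / 2, 0; 0, -(α + β + v + 4) / 2]))

/-- The second-order operator
`D₀ = ∂²(1 - x²) I + ∂ (β - α - x (α + β + 4)) I + diag(-c₁, -c₂)`: the scalar Jacobi operator
with parameters `α + 1`, `β + 1`, plus a constant diagonal matrix. -/
def jacD0 : DiffOp 2 :=
  Finsupp.single 2 (1 - X ^ 2) +
  Finsupp.single 1 (C (cmat ((β - α) • 1)) - C (cmat ((α + β + 4) • 1)) * X) +
  Finsupp.single 0 (C (cmat
    !![-((-v + 4 + α + β) * (v + 2 + α + β) / 4), 0;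
       0, -((α + β + v + 4) * (-v + 2 + α + β) / 4)]))

/-- The constant matrix `S = -W₂ / 4`, as an operator of order zero. -/
def jacS : DiffOp 2 := Finsupp.single 0 (C (cmat ((-1 / 4 : ℝ) • jacW2 α β v)))

/-- `𝒩 = 𝒩₀ S`. -/
def jacN : DiffOp 2 := opComp (jacN0 α β v) (jacS α β v)

/-- `D = D₀ S`. -/
def jacD : DiffOp 2 := opComp (jacD0 α β v) (jacS α β v)

end Jacobi

end MatrixDarboux

end

open MatrixDarboux

open MatrixDarboux

namespace MatrixDarboux

/-! Write `K` for `jacK` and `S = -W₂/4`. The leading coefficients of `𝒱` and `𝒩₀` are `x + K` and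
`-x + K`, and `K² = 1`, so their product is `1 - x²`. The lower terms match as well, and `D₀ = 𝒱𝒩₀`
is the scalar Jacobi operator with parameters `α + 1`, `β + 1` plus a constant diagonal matrix.

Two matrix identities tie `𝒱` to the weights: `jac_symbol_mul_quad` compares the symbols, and
`jac_pearson` is what its derivative must satisfy. Together they say `𝒩 = W 𝒱* W̃⁻¹`. Since `W̃`
vanishes at `±1`, integration by parts has no boundary term, and `𝒱`, `𝒩` are adjoint to each other
(`form_act_jacV`).

Consequently `⟨P·D, Q⟩ = ⟨P·𝒱, Q·𝒱⟩_W = ⟨P, Q·D⟩` for the weight `W̃`. Scalar Jacobi polynomials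
exist because the Jacobi operator is triangular with distinct eigenvalues. They are eigenfunctions
of the symmetric `D`, hence orthogonal for `W̃`. Then `⟨Pₙ·𝒱, Pₘ·𝒱⟩_W = ⟨Pₙ, Pₘ·D⟩ = 0` for `n ≠ m`.
On degree `n`, `𝒱` multiplies the leading coefficient by an invertible constant matrix, so `Pₙ·𝒱`
normalizes to the monic orthogonal polynomials of `W`.

Irreducibility is separate: a splitting of `W` splits each coefficient, and `W₀`, `W₁` already force
two rows of `M` to be dependent. -/

/-! ### Evaluation of matrix polynomials and sesquilinearity of the form. -/

/-- Evaluation at a real point, as a ring homomorphism. -/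
noncomputable def evalHom (N : ℕ) (x : ℝ) : MatPoly N →+* CMat N :=
  eval₂RingHom' (RingHom.id _) (algebraMap ℂ (CMat N) (x : ℂ))
    (fun a => (Algebra.commutes _ a).symm)

theorem evalAt_add {N : ℕ} (P Q : MatPoly N) (x : ℝ) :
    evalAt (P + Q) x = evalAt P x + evalAt Q x := map_add (evalHom N x) P Q

/-- Multiplicativity survives noncommuting coefficients because the evaluation point is a scalar
matrix, hence central. -/
theorem evalAt_mul {N : ℕ} (P Q : MatPoly N) (x : ℝ) :
    evalAt (P * Q) x = evalAt P x * evalAt Q x := map_mul (evalHom N x) P Q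

theorem evalAt_neg {N : ℕ} (P : MatPoly N) (x : ℝ) :
    evalAt (-P) x = -evalAt P x := map_neg (evalHom N x) P

theorem evalAt_zero {N : ℕ} (x : ℝ) : evalAt (0 : MatPoly N) x = 0 := map_zero (evalHom N x)

theorem evalAt_C {N : ℕ} (A : CMat N) (x : ℝ) : evalAt (C A) x = A := eval_C

theorem evalAt_X {N : ℕ} (x : ℝ) : evalAt (X : MatPoly N) x = (x : ℂ) • 1 := by
  rw [evalAt, eval_X, Algebra.algebraMap_eq_smul_one]

theorem evalAt_monomial {N : ℕ} (n : ℕ) (A : CMat N) (x : ℝ) :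
    evalAt (monomial n A) x = (x : ℂ) ^ n • A := by
  rw [evalAt, eval_monomial, ← map_pow, ← Algebra.commutes, ← Algebra.smul_def]

theorem evalAt_map {N : ℕ} (p : ℂ[X]) (x : ℝ) :
    evalAt (p.map (algebraMap ℂ (CMat N)) : MatPoly N) x = p.eval (x : ℂ) • 1 := by
  rw [evalAt, eval_map_algebraMap, aeval_algebraMap_apply_eq_algebraMap_eval,
    Algebra.algebraMap_eq_smul_one]

/-- Entrywise differentiability of a matrix-valued function. -/
def MatHasDerivAt {N : ℕ} (A : ℝ → CMat N) (A' : CMat N) (x : ℝ) : Prop :=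
  ∀ i j, HasDerivAt (fun y => A y i j) (A' i j) x

theorem MatHasDerivAt.mul {N : ℕ} {A B : ℝ → CMat N} {A' B' : CMat N} {x : ℝ}
    (hA : MatHasDerivAt A A' x) (hB : MatHasDerivAt B B' x) :
    MatHasDerivAt (fun y => A y * B y) (A' * B x + A x * B') x := by
  intro i j
  simp only [Matrix.mul_apply, Matrix.add_apply, ← Finset.sum_add_distrib]
  exact HasDerivAt.fun_sum fun k _ => (hA i k).mul (hB k j)

theorem MatHasDerivAt.conjTranspose {N : ℕ} {A : ℝ → CMat N} {A' : CMat N} {x : ℝ}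
    (hA : MatHasDerivAt A A' x) : MatHasDerivAt (fun y => (A y)ᴴ) A'ᴴ x := fun i j =>
  (hA j i).star

theorem matHasDerivAt_evalAt {N : ℕ} (P : MatPoly N) (x : ℝ) :
    MatHasDerivAt (evalAt P) (evalAt (derivative P) x) x := by
  intro i j
  induction P using Polynomial.induction_on' with
  | add P Q hP hQ =>
    simp only [derivative_add, evalAt_add, Matrix.add_apply]
    exact hP.add hQ
  | monomial n A =>
    simp only [derivative_monomial, evalAt_monomial, Matrix.smul_apply, smul_eq_mul]
    have h := ((hasDerivAt_pow n (x : ℂ)).comp_ofReal).mul_const (A i j)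
    refine h.congr_deriv ?_
    rw [← nsmul_eq_mul', Matrix.smul_apply, nsmul_eq_mul]
    ring

theorem continuous_evalAt {N : ℕ} (P : MatPoly N) (i j : Fin N) :
    Continuous fun x => evalAt P x i j :=
  continuous_iff_continuousAt.2 fun x => (matHasDerivAt_evalAt P x i j).continuousAt

theorem IsWeight.integrableOn_form {N : ℕ} {I : Set ℝ} {W : ℝ → CMat N} (hW : IsWeight I W)
    (P Q : MatPoly N) (i j : Fin N) :
    IntegrableOn (fun x => (evalAt P x * W x * (evalAt Q x)ᴴ) i j) I := by
  induction P using Polynomial.induction_on' with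
  | add P R hP hR =>
    simp only [evalAt_add, add_mul, Matrix.add_apply]
    exact hP.add hR
  | monomial n A =>
    induction Q using Polynomial.induction_on' with
    | add Q R hQ hR =>
      simp only [evalAt_add, Matrix.conjTranspose_add, mul_add, Matrix.add_apply]
      exact hQ.add hR
    | monomial m B =>
      have h : ∀ x : ℝ, (evalAt (monomial n A) x * W x * (evalAt (monomial m B) x)ᴴ) i j =
          ∑ l, ∑ k, (x : ℂ) ^ (n + m) * W x k l * (A i k * star (B j l)) := by
        intro x
        simp only [evalAt_monomial, Matrix.mul_apply, Matrix.smul_apply, smul_eq_mul,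
          Matrix.conjTranspose_apply, Finset.sum_mul]
        refine Finset.sum_congr rfl fun l _ => Finset.sum_congr rfl fun k _ => ?_
        have : star ((x : ℂ) ^ m * B j l) = (x : ℂ) ^ m * star (B j l) := by
          simp
        rw [this]
        ring
      simp only [h]
      exact integrable_finsetSum _ fun l _ => integrable_finsetSum _ fun k _ =>
        (hW.moments (n + m) k l).mul_const _

theorem IsWeight.form_C_mul_left {N : ℕ} {I : Set ℝ} {W : ℝ → CMat N} (hW : IsWeight I W)
    (A : CMat N) (P Q : MatPoly N) : form I W (C A * P) Q = A * form I W P Q := by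
  ext i j
  rw [Matrix.mul_apply]
  simp only [form, Matrix.of_apply, evalAt_mul, evalAt_C, ← integral_const_mul]
  rw [← integral_finsetSum _ fun k _ => (hW.integrableOn_form P Q k j).const_mul _]
  refine integral_congr_ae (Filter.Eventually.of_forall fun x => ?_)
  change (A * evalAt P x * W x * (evalAt Q x)ᴴ) i j = _
  rw [mul_assoc A, mul_assoc A, Matrix.mul_apply]

theorem IsWeight.form_conjTranspose {N : ℕ} {I : Set ℝ} {W : ℝ → CMat N} (hW : IsWeight I W)
    (P Q : MatPoly N) : (form I W P Q)ᴴ = form I W Q P := by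
  ext i j
  simp only [form, Matrix.of_apply, Matrix.conjTranspose_apply]
  rw [← starRingEnd_apply, ← integral_conj]
  refine integral_congr_ae ?_
  filter_upwards [hW.posDef] with x hx
  rw [starRingEnd_apply, ← Matrix.conjTranspose_apply]
  simp only [Matrix.conjTranspose_mul, Matrix.conjTranspose_conjTranspose, hx.isHermitian.eq,
    mul_assoc]

theorem IsWeight.form_C_mul_right {N : ℕ} {I : Set ℝ} {W : ℝ → CMat N} (hW : IsWeight I W)
    (A : CMat N) (P Q : MatPoly N) : form I W P (C A * Q) = form I W P Q * Aᴴ := by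
  rw [← hW.form_conjTranspose, hW.form_C_mul_left, Matrix.conjTranspose_mul,
    hW.form_conjTranspose]

/-! ### Bilinearity of composition, degree preservation, integration by parts. -/

theorem opComp_single {N : ℕ} (i j : ℕ) (F G : MatPoly N) :
    opComp (Finsupp.single i F) (Finsupp.single j G) = ∑ k ∈ Finset.range (j + 1),
      Finsupp.single (i + k) (j.choose k • (derivative^[j - k] F * G)) := by
  rw [opComp, Finsupp.sum_single_index, Finsupp.sum_single_index]
  · simp
  · simp [Finsupp.sum]

theorem opComp_add_left {N : ℕ} (V V' E : DiffOp N) :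
    opComp (V + V') E = opComp V E + opComp V' E := by
  refine Finsupp.sum_add_index' (fun i => ?_) fun i F F' => ?_
  · simp [Finsupp.sum]
  · simp only [Finsupp.sum, ← Finset.sum_add_distrib, iterate_map_add, add_mul, smul_add,
      Finsupp.single_add]

theorem opComp_add_right {N : ℕ} (V E E' : DiffOp N) :
    opComp V (E + E') = opComp V E + opComp V E' := by
  unfold opComp
  rw [← Finsupp.sum_add]
  refine Finsupp.sum_congr fun i _ => Finsupp.sum_add_index' (fun j => ?_) fun j G G' => ?_
  · simp
  · simp only [← Finset.sum_add_distrib, mul_add, smul_add, Finsupp.single_add]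

/-- At the top degree `n` of `P` the `K` term vanishes, so the leading coefficient is just
multiplied by `U n`. Matrices have zero divisors, so `U n` must be a unit and not merely nonzero. -/
theorem degreePreserving_of_coeff {N : ℕ} {V : DiffOp N} (U K : ℕ → CMat N)
    (hU : ∀ n, IsUnit (U n))
    (h : ∀ (P : MatPoly N) (n : ℕ), (act P V).coeff n = P.coeff n * U n + P.coeff (n + 1) * K n) :
    DegreePreserving V := by
  intro P
  apply le_antisymm
  · rw [degree_le_iff_coeff_zero]
    intro m hm
    have hm' : P.degree < (m + 1 : ℕ) := hm.trans (by exact_mod_cast Nat.lt_succ_self m)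
    rw [h, coeff_eq_zero_of_degree_lt hm, coeff_eq_zero_of_degree_lt hm', zero_mul, zero_mul,
      add_zero]
  · by_cases hP : P = 0
    · simp [hP]
    rw [degree_eq_natDegree hP]
    refine le_degree_of_ne_zero ?_
    rw [h, coeff_eq_zero_of_natDegree_lt (Nat.lt_succ_self _), zero_mul, add_zero, Ne,
      (hU _).mul_left_eq_zero]
    exact leadingCoeff_ne_zero.2 hP

/-- If a first-order operator `V = ∂ F₁ + F₀` and `E = ∂ G₁ + G₀` satisfy the first-order form of
`E = W V* W'⁻¹`, and the boundary terms vanish, then `V` and `E` are adjoint to each other. -/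
theorem form_act_eq_of_matHasDerivAt {N : ℕ} {a b : ℝ} (hab : a ≤ b) {W W' : ℝ → CMat N}
    (hW : IsWeight (Set.Ioo a b) W) (hW' : IsWeight (Set.Ioo a b) W') {F₀ F₁ G₀ G₁ : MatPoly N}
    (hc : ∀ i j, ContinuousOn (fun x => W' x i j) (Set.Icc a b)) (ha : W' a = 0) (hb : W' b = 0)
    (hT : ∀ x ∈ Set.Ioo a b, evalAt F₁ x * W x = -(W' x * (evalAt G₁ x)ᴴ))
    (hT' : ∀ x ∈ Set.Ioo a b, MatHasDerivAt (fun y => -(W' y * (evalAt G₁ y)ᴴ))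
      (evalAt F₀ x * W x - W' x * (evalAt G₀ x)ᴴ) x) (P Q : MatPoly N) :
    form (Set.Ioo a b) W (derivative P * F₁ + P * F₀) Q =
      form (Set.Ioo a b) W' P (derivative Q * G₁ + Q * G₀) := by
  ext i j
  simp only [form, Matrix.of_apply]
  rw [← sub_eq_zero, ← integral_sub (hW.integrableOn_form _ _ i j) (hW'.integrableOn_form _ _ i j)]
  -- The boundary term. On the open interval it equals `P F₁ W Qᴴ`, but it is written with `W'`,
  -- which is continuous up to the endpoints and zero there, while nothing is assumed about `W` at
  -- the endpoints.
  set B : ℝ → CMat N := fun x => evalAt P x * -(W' x * (evalAt G₁ x)ᴴ) * (evalAt Q x)ᴴ with hB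
  have hd : ∀ x ∈ Set.Ioo a b, HasDerivAt (fun y => B y i j)
      ((evalAt (derivative P * F₁ + P * F₀) x * W x * (evalAt Q x)ᴴ) i j -
        (evalAt P x * W' x * (evalAt (derivative Q * G₁ + Q * G₀) x)ᴴ) i j) x := by
    intro x hx
    have h := (((matHasDerivAt_evalAt P x).mul (hT' x hx)).mul
      (matHasDerivAt_evalAt Q x).conjTranspose) i j
    convert h using 1
    rw [← Matrix.sub_apply]
    refine congrFun (congrFun ?_ i) j
    simp only [evalAt_add, evalAt_mul, Matrix.conjTranspose_add, Matrix.conjTranspose_mul]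
    rw [← hT x hx]
    have e : evalAt P x * (evalAt F₁ x * W x) * (evalAt (derivative Q) x)ᴴ =
        -(evalAt P x * (W' x * (evalAt G₁ x)ᴴ) * (evalAt (derivative Q) x)ᴴ) := by
      rw [hT x hx, mul_neg, neg_mul]
    rw [e]
    noncomm_ring
  have hBc : ContinuousOn (fun x => B x i j) (Set.Icc a b) := by
    simp only [hB, Matrix.mul_apply, Matrix.neg_apply, Matrix.conjTranspose_apply]
    refine continuousOn_finsetSum _ fun k _ => ContinuousOn.mul
      (continuousOn_finsetSum _ fun l _ => (continuous_evalAt P i l).continuousOn.mul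
        (continuousOn_finsetSum _ fun m _ => ?_).neg)
      (continuous_evalAt Q j k).star.continuousOn
    exact (hc l m).mul (continuous_evalAt G₁ k m).star.continuousOn
  have hint : IntegrableOn (fun x =>
      (evalAt (derivative P * F₁ + P * F₀) x * W x * (evalAt Q x)ᴴ) i j -
        (evalAt P x * W' x * (evalAt (derivative Q * G₁ + Q * G₀) x)ᴴ) i j) (Set.Ioo a b) :=
    (hW.integrableOn_form _ _ i j).sub (hW'.integrableOn_form _ _ i j)
  have hft := intervalIntegral.integral_eq_sub_of_hasDerivAt_of_le hab hBc hd
    ((intervalIntegrable_iff_integrableOn_Ioo_of_le hab).2 hint)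
  rw [intervalIntegral.integral_of_le hab, integral_Ioc_eq_integral_Ioo] at hft
  rw [hft]
  simp [hB, ha, hb]

/-! ### Real matrices inside complex ones, and products of first-order operators. -/

theorem cmat_eq_mapMatrix (M : Matrix (Fin 2) (Fin 2) ℝ) :
    cmat M = Complex.ofRealHom.mapMatrix M := rfl

theorem cmat_mul (M N : Matrix (Fin 2) (Fin 2) ℝ) : cmat (M * N) = cmat M * cmat N := by
  simp only [cmat_eq_mapMatrix, map_mul]

theorem cmat_add (M N : Matrix (Fin 2) (Fin 2) ℝ) : cmat (M + N) = cmat M + cmat N := by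
  simp only [cmat_eq_mapMatrix, map_add]

theorem cmat_sub (M N : Matrix (Fin 2) (Fin 2) ℝ) : cmat (M - N) = cmat M - cmat N := by
  simp only [cmat_eq_mapMatrix, map_sub]

theorem cmat_neg (M : Matrix (Fin 2) (Fin 2) ℝ) : cmat (-M) = -cmat M := by
  simp only [cmat_eq_mapMatrix, map_neg]

theorem cmat_one : cmat 1 = 1 := by
  simp only [cmat_eq_mapMatrix, map_one]

theorem cmat_smul (c : ℝ) (M : Matrix (Fin 2) (Fin 2) ℝ) : cmat (c • M) = (c : ℂ) • cmat M := by
  ext i j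
  simp [cmat]

theorem cmat_conjTranspose (M : Matrix (Fin 2) (Fin 2) ℝ) : (cmat M)ᴴ = cmat Mᵀ := by
  ext i j
  simp [cmat]

theorem cmat_isUnit {M : Matrix (Fin 2) (Fin 2) ℝ} (h : M.det ≠ 0) : IsUnit (cmat M) :=
  ((Matrix.isUnit_iff_isUnit_det M).2 h.isUnit).map Complex.ofRealHom.mapMatrix

theorem opComp_single_zero {N : ℕ} (n : ℕ) (F G : MatPoly N) :
    opComp (Finsupp.single n F) (Finsupp.single 0 G) = Finsupp.single n (F * G) := by
  rw [opComp_single]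
  simp only [zero_add, Finset.sum_range_one, Nat.choose_self, add_zero, one_smul]
  rfl

theorem opComp_first_order {N : ℕ} (F₁ F₀ G₁ G₀ : MatPoly N) :
    opComp (Finsupp.single 1 F₁ + Finsupp.single 0 F₀)
      (Finsupp.single 1 G₁ + Finsupp.single 0 G₀) =
    Finsupp.single 2 (F₁ * G₁) +
      Finsupp.single 1 (derivative F₁ * G₁ + F₁ * G₀ + F₀ * G₁) +
      Finsupp.single 0 (derivative F₀ * G₁ + F₀ * G₀) := by
  simp only [opComp_add_left, opComp_add_right, opComp_single, Finset.sum_range_succ,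
    Finset.sum_range_zero, Finsupp.single_add]
  simp
  abel

theorem act_first_order {N : ℕ} (P F₁ F₀ : MatPoly N) :
    act P (Finsupp.single 1 F₁ + Finsupp.single 0 F₀) = derivative P * F₁ + P * F₀ := by
  simp [act_add, act_single]

/-! ### Algebraic identities for the Jacobi-type data. -/

noncomputable section

variable (α β v : ℝ)

/-- The constant part of the leading coefficients of `𝒱` and `𝒩₀`. -/
def jacK : Matrix (Fin 2) (Fin 2) ℝ :=
  !![(β - α) / v, 1 + (β - α) / v; 1 + (α - β) / v, (α - β) / v]

/-- The zeroth-order coefficient of `𝒱`. -/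
def jacF : Matrix (Fin 2) (Fin 2) ℝ := !![(v + 2 + α + β) / 2, 0; 0, (-v + 2 + α + β) / 2]

/-- The zeroth-order coefficient of `𝒩₀`. -/
def jacG : Matrix (Fin 2) (Fin 2) ℝ := !![-(-v + 4 + α + β) / 2, 0; 0, -(α + β + v + 4) / 2]

/-- The quadratic matrix polynomial in the weight `W`. -/
def jacQuad (x : ℝ) : Matrix (Fin 2) (Fin 2) ℝ :=
  ((1 - x) ^ 2 / 4) • jacW2 α β v + ((1 - x) / 2) • jacW1 α β v + jacW0 α

variable {α β v}

theorem jacK_transpose : (jacK α β v)ᵀ =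
    !![(β - α) / v, 1 + (α - β) / v; 1 + (β - α) / v, (α - β) / v] := by
  ext i j
  fin_cases i <;> fin_cases j <;> rfl

theorem jacV_eq : jacV α β v = Finsupp.single 1 (X + C (cmat (jacK α β v))) +
    Finsupp.single 0 (C (cmat (jacF α β v))) := rfl

theorem jacN0_eq : jacN0 α β v = Finsupp.single 1 (-X + C (cmat (jacK α β v))) +
    Finsupp.single 0 (C (cmat (jacG α β v))) := rfl

theorem jacN_eq : jacN α β v =
    Finsupp.single 1 ((-X + C (cmat (jacK α β v))) * C (cmat ((-1 / 4 : ℝ) • jacW2 α β v))) +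
    Finsupp.single 0 (C (cmat (jacG α β v)) * C (cmat ((-1 / 4 : ℝ) • jacW2 α β v))) := by
  rw [jacN, jacS, jacN0_eq, opComp_add_left, opComp_single_zero, opComp_single_zero]

theorem jacF_mul_jacG : jacF α β v * jacG α β v =
    !![-((-v + 4 + α + β) * (v + 2 + α + β) / 4), 0;
       0, -((α + β + v + 4) * (-v + 2 + α + β) / 4)] := by
  ext i j
  fin_cases i <;> fin_cases j <;>
    simp [jacF, jacG, Matrix.mul_apply, Fin.sum_univ_two] <;> ring

theorem jacD0_eq_opComp (hv : v ≠ 0) : jacD0 α β v = opComp (jacV α β v) (jacN0 α β v) := by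
  -- `K² = 1` turns `(X + K)(-X + K)` into `1 - X²`. The next two identities are the constant and
  -- the linear part of the coefficient of `∂`.
  have h2 : jacK α β v * jacK α β v = 1 := by
    ext i j
    fin_cases i <;> fin_cases j <;> simp [jacK, Matrix.mul_apply, Fin.sum_univ_two] <;>
      field_simp <;> ring
  have h1 : (β - α) • (1 : Matrix (Fin 2) (Fin 2) ℝ) =
      jacK α β v + jacK α β v * jacG α β v + jacF α β v * jacK α β v := by
    ext i j
    fin_cases i <;> fin_cases j <;> simp [jacK, jacF, jacG] <;> field_simp <;> ring
  have h1' : (α + β + 4) • (1 : Matrix (Fin 2) (Fin 2) ℝ) = 1 - jacG α β v + jacF α β v := by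
    ext i j
    fin_cases i <;> fin_cases j <;> simp [jacF, jacG] <;> ring
  rw [jacV_eq, jacN0_eq, opComp_first_order, jacD0, ← jacF_mul_jacG, h1, h1']
  congr 1
  · congr 1
    · congr 1
      have e : C (cmat (jacK α β v)) * C (cmat (jacK α β v)) = (1 : MatPoly 2) := by
        rw [← C_mul, ← cmat_mul, h2, cmat_one, C_1]
      rw [mul_add, add_mul, add_mul, e, mul_neg, mul_neg, ← sq, X_mul]
      abel
    · congr 1
      simp only [cmat_add, cmat_sub, cmat_mul, cmat_one, C_add, C_sub, C_mul, C_1, derivative_add,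
        derivative_X, derivative_C, add_zero, one_mul, add_mul, mul_add, sub_mul, mul_neg]
      rw [X_mul]
      abel
  · congr 1
    rw [derivative_C, zero_mul, zero_add, ← C_mul, cmat_mul]

theorem jacD_eq_opComp (hv : v ≠ 0) : jacD α β v = opComp (jacV α β v) (jacN α β v) := by
  rw [jacN_eq, jacD, jacD0_eq_opComp hv, jacV_eq, jacN0_eq, jacS, opComp_first_order,
    opComp_first_order]
  simp only [opComp_add_left, opComp_single_zero, add_mul, mul_assoc]

/-- The sign `c = 1` serves `𝒱` and `c = -1` serves `𝒩₀`. Multiplying `P'` by `X` restores the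
degree and leaves the factor `n`; the constant `K` sees the shifted coefficient. -/
theorem coeff_act_linear {N : ℕ} (c : ℤ) (K F : CMat N) (P : MatPoly N) (n : ℕ) :
    (derivative P * (c • X + C K) + P * C F).coeff n =
      P.coeff n * ((c * n) • (1 : CMat N) + F) + P.coeff (n + 1) * ((n + 1) • K) := by
  rw [mul_add, mul_smul_comm, coeff_add, coeff_add, coeff_smul, coeff_mul_C, coeff_mul_C,
    coeff_derivative]
  cases n with
  | zero => simp [add_comm]
  | succ n =>
    rw [coeff_mul_X, coeff_derivative, mul_add]
    simp only [mul_one, nsmul_eq_mul, zsmul_eq_mul]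
    push_cast
    rw [← mul_add_one, ← mul_assoc (c : CMat N), (Int.cast_commute c (P.coeff (n + 1))).eq]
    noncomm_ring

theorem coeff_act_jacV (P : MatPoly 2) (n : ℕ) : (act P (jacV α β v)).coeff n =
    P.coeff n * cmat ((n : ℝ) • 1 + jacF α β v) +
      P.coeff (n + 1) * ((n + 1) • cmat (jacK α β v)) := by
  have := coeff_act_linear 1 (cmat (jacK α β v)) (cmat (jacF α β v)) P n
  rw [jacV_eq, act_first_order]
  rw [one_smul] at this
  rw [this, cmat_add, cmat_smul, cmat_one]
  simp [Nat.cast_smul_eq_nsmul]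

theorem coeff_act_jacN0 (P : MatPoly 2) (n : ℕ) : (act P (jacN0 α β v)).coeff n =
    P.coeff n * cmat (-(n : ℝ) • 1 + jacG α β v) +
      P.coeff (n + 1) * ((n + 1) • cmat (jacK α β v)) := by
  have := coeff_act_linear (-1) (cmat (jacK α β v)) (cmat (jacG α β v)) P n
  rw [jacN0_eq, act_first_order]
  rw [neg_one_smul] at this
  rw [this, cmat_add, cmat_smul, cmat_one]
  simp [Nat.cast_smul_eq_nsmul]

/-- The diagonal entries are `n + (±v + α + β + 2) / 2`, positive since `|v| < α + β + 2`. -/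
theorem jacV_symbol_isUnit (hv' : |v| < α + β + 2) (n : ℕ) :
    IsUnit (cmat ((n : ℝ) • 1 + jacF α β v)) := by
  obtain ⟨h1, h2⟩ := abs_lt.1 hv'
  have hn : (0 : ℝ) ≤ n := n.cast_nonneg
  refine cmat_isUnit ?_
  simp only [jacF, Matrix.det_fin_two, Matrix.add_apply, Matrix.smul_apply]
  simp
  constructor <;> apply ne_of_gt <;> linarith

theorem jacN0_symbol_isUnit (hv' : |v| < α + β + 2) (n : ℕ) :
    IsUnit (cmat (-(n : ℝ) • 1 + jacG α β v)) := by
  obtain ⟨h1, h2⟩ := abs_lt.1 hv'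
  have hn : (0 : ℝ) ≤ n := n.cast_nonneg
  refine cmat_isUnit ?_
  simp only [jacG, Matrix.det_fin_two, Matrix.add_apply, Matrix.smul_apply]
  simp
  constructor <;> apply ne_of_lt <;> linarith

theorem degreePreserving_jacV (hv' : |v| < α + β + 2) : DegreePreserving (jacV α β v) :=
  degreePreserving_of_coeff _ _ (jacV_symbol_isUnit hv') coeff_act_jacV

theorem degreePreserving_jacN0 (hv' : |v| < α + β + 2) : DegreePreserving (jacN0 α β v) :=
  degreePreserving_of_coeff _ _ (jacN0_symbol_isUnit hv') coeff_act_jacN0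

theorem jac_bounds (hv : |α - β| < |v|) (hv' : |v| < α + β + 2) :
    -1 < α ∧ -1 < β ∧ v ≠ 0 ∧ v + α - β ≠ 0 ∧ v - α + β ≠ 0 ∧
      0 < v * (v + α - β) ∧ 0 < v * (v - α + β) ∧ 0 < v + 2 + α + β ∧ 0 < -v + 2 + α + β := by
  obtain ⟨h1, h2⟩ := abs_lt.1 hv'
  obtain ⟨h3, h4⟩ := abs_lt.1 (hv.trans hv')
  have h5 : v ≠ 0 := abs_pos.1 ((abs_nonneg _).trans_lt hv)
  obtain ⟨h6, h7⟩ := abs_lt.1 hv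
  have h8 : 0 < v * (v + α - β) ∧ 0 < v * (v - α + β) := by
    rcases lt_or_gt_of_ne h5 with h | h
    · rw [abs_of_neg h] at h6 h7
      exact ⟨mul_pos_of_neg_of_neg h (by linarith), mul_pos_of_neg_of_neg h (by linarith)⟩
    · rw [abs_of_pos h] at h6 h7
      exact ⟨mul_pos h (by linarith), mul_pos h (by linarith)⟩
  exact ⟨by linarith, by linarith, h5, right_ne_zero_of_mul h8.1.ne',
    right_ne_zero_of_mul h8.2.ne', h8.1, h8.2, by linarith, by linarith⟩

theorem jacW2_diag_pos (hv : |α - β| < |v|) (hv' : |v| < α + β + 2) :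
    0 < jacW2 α β v 0 0 ∧ 0 < jacW2 α β v 1 1 := by
  obtain ⟨-, -, h0, h1, h2, h3, h4, h5, h6⟩ := jac_bounds hv hv'
  constructor
  -- With a square in the denominator, the sign is read off from `v (v + α - β) > 0`, whatever the
  -- sign of `v`.
  · have : jacW2 α β v 0 0 = v * (v + α - β) * (v + 2 + α + β) / (v + α - β) ^ 2 := by
      simp [jacW2]
      field_simp
    rw [this]
    positivity
  · have : jacW2 α β v 1 1 = v * (v - α + β) * (-v + 2 + α + β) / (v - α + β) ^ 2 := by
      simp [jacW2]
      field_simp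
    rw [this]
    positivity

theorem jacS_isUnit (hv : |α - β| < |v|) (hv' : |v| < α + β + 2) :
    IsUnit (cmat ((-1 / 4 : ℝ) • jacW2 α β v)) := by
  obtain ⟨h1, h2⟩ := jacW2_diag_pos hv hv'
  refine cmat_isUnit ?_
  have h : jacW2 α β v 0 1 = 0 := rfl
  rw [Matrix.det_fin_two]
  simp only [Matrix.smul_apply, h, smul_eq_mul]
  nlinarith [mul_pos h1 h2]

theorem degreePreserving_jacN (hv : |α - β| < |v|) (hv' : |v| < α + β + 2) :
    DegreePreserving (jacN α β v) := by
  refine degreePreserving_of_coeff _ (fun n => (n + 1) • cmat (jacK α β v) *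
    cmat ((-1 / 4 : ℝ) • jacW2 α β v)) (fun n => (jacN0_symbol_isUnit hv' n).mul
      (jacS_isUnit hv hv')) fun P n => ?_
  have : act P (jacN α β v) = act P (jacN0 α β v) * C (cmat ((-1 / 4 : ℝ) • jacW2 α β v)) := by
    rw [jacN, act_opComp, jacS, act_single]
    rfl
  rw [this, coeff_mul_C, coeff_act_jacN0, add_mul, mul_assoc, mul_assoc]

/-- The factor `1 - x²` is exactly the ratio of the two scalar weights, so this is the equality of
the coefficients of `∂` in `𝒩 = W 𝒱* W̃⁻¹`, up to conjugate transpose. -/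
theorem jac_symbol_mul_quad (hv : |α - β| < |v|) (hv' : |v| < α + β + 2) (x : ℝ) :
    (x • 1 + jacK α β v) * jacQuad α β v x =
      (1 - x ^ 2) • (x • ((-1 / 4 : ℝ) • jacW2 α β v) -
        ((-1 / 4 : ℝ) • jacW2 α β v) * (jacK α β v)ᵀ) := by
  obtain ⟨-, -, h0, h1, h2, -⟩ := jac_bounds hv hv'
  rw [jacK_transpose]
  ext i j
  fin_cases i <;> fin_cases j <;>
    simp [jacK, jacQuad, jacW2, jacW1, jacW0, Matrix.mul_apply, Fin.sum_univ_two] <;>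
    field_simp <;> ring

/-- A matrix Pearson equation: the left side is the derivative of `(1-x)^(α+1) (1+x)^(β+1) (x S - S
Kᵀ)` divided by `(1-x)^α (1+x)^β`. It gives the zeroth-order part of the adjoint relation. -/
theorem jac_pearson (hv : |α - β| < |v|) (hv' : |v| < α + β + 2) (x : ℝ) :
    (β - α - x * (α + β + 2)) • (x • ((-1 / 4 : ℝ) • jacW2 α β v) -
        ((-1 / 4 : ℝ) • jacW2 α β v) * (jacK α β v)ᵀ) + (1 - x ^ 2) • ((-1 / 4 : ℝ) • jacW2 α β v) =
      jacF α β v * jacQuad α β v x -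
        (1 - x ^ 2) • (((-1 / 4 : ℝ) • jacW2 α β v) * jacG α β v) := by
  obtain ⟨-, -, h0, h1, h2, -⟩ := jac_bounds hv hv'
  rw [jacK_transpose]
  ext i j
  fin_cases i <;> fin_cases j <;>
    simp [jacQuad, jacW2, jacW1, jacW0, jacF, jacG] <;>
    field_simp <;> ring

theorem jacQuad_posDef (hv : |α - β| < |v|) (hv' : |v| < α + β + 2) {x : ℝ} (hx : x ∈ jacI) :
    0 < jacQuad α β v x 0 0 ∧ jacQuad α β v x 1 0 = jacQuad α β v x 0 1 ∧
      0 < (jacQuad α β v x).det := by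
  obtain ⟨hp, hq⟩ := jacW2_diag_pos hv hv'
  obtain ⟨-, -, h0, h1, h2, h3, h4, h5, h6⟩ := jac_bounds hv hv'
  obtain ⟨hx1, hx2⟩ := hx
  refine ⟨?_, ?_, ?_⟩
  -- Completing the square in `1 - x`; the remainder is minus the discriminant, arranged as a
  -- quotient of positive quantities.
  · have e : 4 * jacW2 α β v 0 0 * jacQuad α β v x 0 0 =
        (jacW2 α β v 0 0 * (1 - x) - (v + 2 + α + β)) ^ 2 +
          (v + 2 + α + β) * (-v + 2 + α + β) * ((v * (v + α - β)) * (v * (v - α + β))) /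
            (v * (v + α - β)) ^ 2 := by
      simp [jacQuad, jacW2, jacW1, jacW0]
      field_simp
      ring
    refine pos_of_mul_pos_right (a := 4 * jacW2 α β v 0 0) ?_ (by positivity)
    rw [e]
    positivity
  · simp [jacQuad, jacW2, jacW1, jacW0]
  · have e : (jacQuad α β v x).det =
        jacW2 α β v 0 0 * jacW2 α β v 1 1 * ((1 - x) * (1 + x)) ^ 2 / 16 := by
      simp [jacQuad, jacW2, jacW1, jacW0, Matrix.det_fin_two]
      field_simp
      ring
    have : 0 < (1 - x) * (1 + x) := mul_pos (by linarith) (by linarith)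
    rw [e]
    positivity

end

/-! ### Positivity, smoothness and moments of the weights. -/

theorem cmat_posDef {M : Matrix (Fin 2) (Fin 2) ℝ} (h0 : 0 < M 0 0) (h1 : M 1 0 = M 0 1)
    (hd : 0 < M.det) : (cmat M).PosDef := by
  -- Gaussian elimination: a congruence to the diagonal matrix of pivots `M 0 0` and `det M / M 0
  -- 0`.
  have e : cmat M = (cmat !![1, M 0 1 / M 0 0; 0, 1])ᴴ *
      Matrix.diagonal ![((M 0 0 : ℝ) : ℂ), ((M.det / M 0 0 : ℝ) : ℂ)] *
      cmat !![1, M 0 1 / M 0 0; 0, 1] := by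
    have e' : Matrix.diagonal ![((M 0 0 : ℝ) : ℂ), ((M.det / M 0 0 : ℝ) : ℂ)] =
        cmat !![M 0 0, 0; 0, M.det / M 0 0] := by
      ext i j
      fin_cases i <;> fin_cases j <;> simp [cmat]
    rw [e', cmat_conjTranspose, ← cmat_mul, ← cmat_mul]
    congr 1
    ext i j
    fin_cases i <;> fin_cases j <;>
      simp [Matrix.mul_apply, Fin.sum_univ_two, h1, Matrix.det_fin_two] <;> field_simp
    ring
  rw [e]
  refine Matrix.PosDef.conjTranspose_mul_mul_same (Matrix.PosDef.diagonal fun i => ?_) ?_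
  · fin_cases i
    · simpa using h0
    · simpa using Complex.zero_lt_real.2 (div_pos hd h0)
  · exact Matrix.mulVec_injective_of_isUnit (cmat_isUnit (by simp [Matrix.det_fin_two]))

/-- Cut at `0`: on each half only one factor can be singular, and the other is continuous. -/
theorem intervalIntegrable_jacobi {a b : ℝ} (ha : -1 < a) (hb : -1 < b) :
    IntervalIntegrable (fun x : ℝ => (1 - x) ^ a * (1 + x) ^ b) volume (-1) 1 := by
  refine IntervalIntegrable.trans (b := 0) ?_ ?_
  · refine IntervalIntegrable.continuousOn_mul ?_ ?_
    · have := (intervalIntegral.intervalIntegrable_rpow' (a := 0) (b := 1) hb).comp_add_left 1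
      simpa using this
    · refine ContinuousOn.rpow_const (by fun_prop) fun x hx => Or.inl ?_
      rw [Set.uIcc_of_le (by norm_num)] at hx
      linarith [hx.2]
  · refine IntervalIntegrable.mul_continuousOn ?_ ?_
    · have := (intervalIntegral.intervalIntegrable_rpow' (a := 1) (b := 0) ha).comp_sub_left 1
      simpa using this
    · refine ContinuousOn.rpow_const (by fun_prop) fun x hx => Or.inl ?_
      rw [Set.uIcc_of_le (by norm_num)] at hx
      linarith [hx.1]

theorem integrableOn_jacobi_mul {a b : ℝ} (ha : -1 < a) (hb : -1 < b) {f : ℝ → ℂ}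
    (hf : Continuous f) :
    IntegrableOn (fun x : ℝ => (((1 - x) ^ a * (1 + x) ^ b : ℝ) : ℂ) * f x) jacI :=
  (intervalIntegrable_iff_integrableOn_Ioo_of_le (by norm_num)).1
    (IntervalIntegrable.mul_continuousOn ⟨(intervalIntegrable_jacobi ha hb).1.ofReal,
      (intervalIntegrable_jacobi ha hb).2.ofReal⟩ hf.continuousOn)

theorem isWeight_jacobi_smul {a b : ℝ} (ha : -1 < a) (hb : -1 < b)
    {Q : ℝ → Matrix (Fin 2) (Fin 2) ℝ} (hQ : ∀ i j, ContDiff ℝ ∞ fun x => Q x i j)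
    (hpos : ∀ x ∈ jacI, 0 < Q x 0 0 ∧ Q x 1 0 = Q x 0 1 ∧ 0 < (Q x).det) :
    IsWeight jacI fun x => cmat (((1 - x) ^ a * (1 + x) ^ b) • Q x) where
  isOpen := isOpen_Ioo
  ordConnected := Set.ordConnected_Ioo
  nonempty := ⟨0, by norm_num [jacI]⟩
  smooth i j := by
    refine Complex.ofRealCLM.contDiff.comp_contDiffOn (ContDiffOn.mul (ContDiffOn.mul ?_ ?_)
      (hQ i j).contDiffOn)
    · exact ContDiffOn.rpow_const_of_ne (by fun_prop) fun x hx => (sub_pos.2 hx.2).ne'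
    · exact ContDiffOn.rpow_const_of_ne (by fun_prop) fun x hx =>
        (by linarith [hx.1] : 0 < 1 + x).ne'
  posDef := by
    refine (ae_restrict_iff' measurableSet_Ioo).2 (Filter.Eventually.of_forall fun x hx => ?_)
    obtain ⟨h0, h1, hd⟩ := hpos x hx
    have hw : 0 < (1 - x) ^ a * (1 + x) ^ b :=
      mul_pos (Real.rpow_pos_of_pos (by linarith [hx.2]) _)
        (Real.rpow_pos_of_pos (by linarith [hx.1]) _)
    refine cmat_posDef (mul_pos hw h0) (by simp [h1]) ?_
    rw [Matrix.det_smul]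
    positivity
  moments n i j := by
    have h : Continuous fun x : ℝ => (x : ℂ) ^ n * (Q x i j : ℂ) :=
      (Complex.continuous_ofReal.pow n).mul (Complex.continuous_ofReal.comp (hQ i j).continuous)
    refine (integrableOn_jacobi_mul ha hb h).congr_fun (fun x _ => ?_) measurableSet_Ioo
    simp only [cmat, Matrix.map_apply, Matrix.smul_apply, smul_eq_mul, Complex.ofReal_mul]
    ring

variable {α β v : ℝ}

theorem isWeight_jacW (hv : |α - β| < |v|) (hv' : |v| < α + β + 2) :
    IsWeight jacI (jacW α β v) := by
  obtain ⟨ha, hb, -⟩ := jac_bounds hv hv'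
  refine isWeight_jacobi_smul ha hb (Q := jacQuad α β v) (fun i j => ?_)
    fun x hx => jacQuad_posDef hv hv' hx
  simp only [jacQuad, Matrix.add_apply, Matrix.smul_apply, smul_eq_mul]
  fun_prop

theorem isWeight_jacDiag (ha : -1 < α) (hb : -1 < β) : IsWeight jacI (jacDiag α β) :=
  isWeight_jacobi_smul (by linarith) (by linarith) (Q := fun _ => 1) (fun _ _ => contDiff_const)
    fun _ _ => by simp

/-! ### Irreducibility of `W`. -/

theorem mul_sub_mul_ne_zero_of_isUnit {M : CMat 2} (hM : IsUnit M) {i j : Fin 2} (hij : i ≠ j) :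
    M i 0 * M j 1 - M i 1 * M j 0 ≠ 0 := by
  have h := ((Matrix.isUnit_iff_isUnit_det M).1 hM).ne_zero
  rw [Matrix.det_fin_two] at h
  contrapose! h
  fin_cases i <;> fin_cases j
  · exact absurd rfl hij
  · exact h
  · change M 1 0 * M 0 1 - M 1 1 * M 0 0 = 0 at h
    linear_combination -h
  · exact absurd rfl hij

theorem not_isReducible_jacW (hv : |α - β| < |v|) (hv' : |v| < α + β + 2) :
    ¬ IsReducible jacI (jacW α β v) := by
  obtain ⟨ha, -, h0, -⟩ := jac_bounds hv hv'
  rintro ⟨M, hM, S, ⟨i, hi⟩, ⟨j, hj⟩, h⟩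
  have hij : i ≠ j := fun e => hj (e ▸ hi)
  have key : ∀ x ∈ jacI, (M * cmat (jacQuad α β v x) * Mᴴ) i j = 0 := by
    intro x hx
    have h2 := (h x hx i hi j hj).1
    have hw : 0 < (1 - x) ^ α * (1 + x) ^ β :=
      mul_pos (Real.rpow_pos_of_pos (by linarith [hx.2]) _)
        (Real.rpow_pos_of_pos (by linarith [hx.1]) _)
    rw [show jacW α β v x = _ from cmat_smul _ _, mul_smul_comm, smul_mul_assoc,
      Matrix.smul_apply, smul_eq_mul] at h2
    exact (mul_eq_zero.1 h2).resolve_left (Complex.ofReal_ne_zero.2 hw.ne')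
  have hq : ∀ x : ℝ, (M * cmat (jacQuad α β v x) * Mᴴ) i j =
      ((1 - x) ^ 2 / 4 : ℝ) * (M * cmat (jacW2 α β v) * Mᴴ) i j +
      ((1 - x) / 2 : ℝ) * (M * cmat (jacW1 α β v) * Mᴴ) i j +
      (M * cmat (jacW0 α) * Mᴴ) i j := by
    intro x
    rw [jacQuad, cmat_add, cmat_add, cmat_smul, cmat_smul]
    simp only [mul_add, add_mul, Matrix.add_apply, mul_smul_comm, smul_mul_assoc,
      Matrix.smul_apply, smul_eq_mul]
  -- Three zeros of a quadratic in `(1 - x) / 2` kill its coefficients; the constants below come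
  -- from interpolation at these points.
  have k1 := hq 0
  have k2 := hq (1 / 2)
  have k3 := hq (-1 / 2)
  rw [key _ (by norm_num [jacI])] at k1 k2 k3
  push_cast at k1 k2 k3
  have e0 : (M * cmat (jacW0 α) * Mᴴ) i j = 0 := by
    linear_combination 3 * k1 - 3 * k2 - k3
  have e1 : (M * cmat (jacW1 α β v) * Mᴴ) i j = 0 := by
    linear_combination -16 * k1 + 10 * k2 + 6 * k3
  have f0 : ((α + 1 : ℝ) : ℂ) * (M i 0 - M i 1) * (star (M j 0) - star (M j 1)) = 0 := by
    rw [← e0]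
    simp [Matrix.mul_apply, Fin.sum_univ_two, cmat, jacW0]
    ring
  -- Here `W₁ = -v diag(1, -1) - (α + β + 2) u uᵀ` with `u = (1, -1)`, while `W₀ = (α + 1) u uᵀ`.
  have f1 : -(v : ℂ) * (M i 0 * star (M j 0) - M i 1 * star (M j 1)) -
      ((α + β + 2 : ℝ) : ℂ) * (M i 0 - M i 1) * (star (M j 0) - star (M j 1)) = 0 := by
    rw [← e1]
    simp [Matrix.mul_apply, Fin.sum_univ_two, cmat, jacW1]
    ring
  have ha' : ((α + 1 : ℝ) : ℂ) ≠ 0 := Complex.ofReal_ne_zero.2 (by linarith)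
  have hv0 : (v : ℂ) ≠ 0 := Complex.ofReal_ne_zero.2 h0
  have hdet := mul_sub_mul_ne_zero_of_isUnit hM hij
  rw [mul_assoc, mul_eq_zero, mul_eq_zero] at f0
  have f2 : (M i 0 - M i 1) * (star (M j 0) - star (M j 1)) = 0 := by
    rw [mul_eq_zero]
    exact f0.resolve_left ha'
  have f3 : M i 0 * star (M j 0) = M i 1 * star (M j 1) := by
    have : (v : ℂ) * (M i 0 * star (M j 0) - M i 1 * star (M j 1)) = 0 := by
      linear_combination -f1 - ((α + β + 2 : ℝ) : ℂ) * f2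
    exact sub_eq_zero.1 ((mul_eq_zero.1 this).resolve_left hv0)
  -- One row of `M` has equal entries. By `f3`, either it is zero or the other row has equal entries
  -- too; in both cases the rows are dependent.
  rcases f0.resolve_left ha' with g | g
  · have g' : M i 0 = M i 1 := sub_eq_zero.1 g
    rw [g'] at f3 hdet
    apply hdet
    by_cases hz : M i 1 = 0
    · simp [hz]
    · rw [star_injective (mul_left_cancel₀ hz f3), sub_self]
  · have g' : M j 0 = M j 1 := star_injective (sub_eq_zero.1 g)
    rw [g'] at f3 hdet
    apply hdet
    by_cases hz : M j 1 = 0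
    · simp [hz]
    · rw [mul_right_cancel₀ (star_ne_zero.2 hz) f3, sub_self]

/-! ### The formal adjoint and the adjunction between `𝒱` and `𝒩`. -/

/-- Replaces the support, which depends on whether `F₁` or `F₀` vanishes, by a fixed range; the
extra terms are zero. -/
theorem adjointCoeff_first_order {N : ℕ} (W W' : ℝ → CMat N) (F₁ F₀ : MatPoly N) (k : ℕ) (x : ℝ) :
    adjointCoeff W (Finsupp.single 1 F₁ + Finsupp.single 0 F₀) W' k x =
      (∑ j ∈ Finset.range 2 with k ≤ j, ((-1 : ℂ) ^ j * (j.choose k : ℂ)) •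
        (Matrix.of fun a b => iteratedDeriv (j - k)
          (fun y : ℝ => (W y * (evalAt ((Finsupp.single 1 F₁ + Finsupp.single 0 F₀ : DiffOp N) j)
            y)ᴴ) a b) x : CMat N)) * (W' x)⁻¹ := by
  rw [adjointCoeff]
  congr 1
  refine Finset.sum_subset (fun j hj => ?_) fun j _ hj' => ?_
  · rw [Finset.mem_filter, Finsupp.mem_support_iff] at hj
    refine Finset.mem_filter.2 ⟨Finset.mem_range.2 ?_, hj.2⟩
    by_contra hlt
    refine hj.1 ?_
    rw [Finsupp.add_apply, Finsupp.single_eq_of_ne (by omega), Finsupp.single_eq_of_ne (by omega),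
      add_zero]
  · have h0 : (Finsupp.single 1 F₁ + Finsupp.single 0 F₀ : DiffOp N) j = 0 := by
      by_contra hne
      exact hj' (Finset.mem_filter.2 ⟨Finsupp.mem_support_iff.2 hne, by simp_all⟩)
    rw [h0]
    simp only [evalAt_zero, Matrix.conjTranspose_zero, mul_zero, Matrix.zero_apply,
      iteratedDeriv_fun_const_zero]
    ext a b
    simp

/-- The adjoint has coefficients `-W F₁ᴴ W'⁻¹` at `∂` and `(W F₀ᴴ - (W F₁ᴴ)') W'⁻¹` at order zero;
the hypotheses are these formulas cleared of the inverse. -/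
theorem isFormalAdjoint_first_order {N : ℕ} {I : Set ℝ} {W W' : ℝ → CMat N}
    {F₁ F₀ G₁ G₀ : MatPoly N} (hW' : ∀ x ∈ I, IsUnit (W' x))
    (h₁ : ∀ x ∈ I, evalAt G₁ x * W' x = -(W x * (evalAt F₁ x)ᴴ))
    (h₀ : ∀ x ∈ I, MatHasDerivAt (fun y => W y * (evalAt F₁ y)ᴴ)
      (W x * (evalAt F₀ x)ᴴ - evalAt G₀ x * W' x) x) :
    IsFormalAdjoint I (Finsupp.single 1 G₁ + Finsupp.single 0 G₀) W
      (Finsupp.single 1 F₁ + Finsupp.single 0 F₀) W' := by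
  intro k x hx
  have hdet := (Matrix.isUnit_iff_isUnit_det _).1 (hW' x hx)
  rw [adjointCoeff_first_order]
  match k with
  | 0 =>
    have e : evalAt G₀ x = evalAt G₀ x * W' x * (W' x)⁻¹ :=
      (Matrix.mul_nonsing_inv_cancel_right _ _ hdet).symm
    simp only [Finset.sum_filter, Finset.sum_range_succ, Finset.sum_range_zero]
    simp only [zero_le, if_true, iteratedDeriv_zero, iteratedDeriv_one, Nat.sub_zero, zero_add]
    simp
    rw [e]
    congr 1
    ext a b
    have := (h₀ x hx a b).deriv
    simp [this]
  | 1 =>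
    have e : evalAt G₁ x = evalAt G₁ x * W' x * (W' x)⁻¹ :=
      (Matrix.mul_nonsing_inv_cancel_right _ _ hdet).symm
    simp [Finset.sum_filter, Finset.sum_range_succ]
    rw [e, h₁ x hx]
    rfl
  | k + 2 =>
    rw [Finset.filter_false_of_mem (by intro j hj; rw [Finset.mem_range] at hj; omega),
      Finset.sum_empty, zero_mul, Finsupp.add_apply, Finsupp.single_eq_of_ne (by omega),
      Finsupp.single_eq_of_ne (by omega), add_zero, evalAt_zero]

theorem evalAt_linear (M : Matrix (Fin 2) (Fin 2) ℝ) (x : ℝ) :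
    evalAt (X + C (cmat M)) x = cmat (x • 1 + M) := by
  rw [evalAt_add, evalAt_X, evalAt_C, cmat_add, cmat_smul, cmat_one]

theorem evalAt_neg_linear (M : Matrix (Fin 2) (Fin 2) ℝ) (x : ℝ) :
    evalAt (-X + C (cmat M)) x = cmat (-(x • 1) + M) := by
  rw [evalAt_add, evalAt_neg, evalAt_X, evalAt_C, cmat_add, cmat_neg, cmat_smul, cmat_one]

theorem jacW2_transpose : (jacW2 α β v)ᵀ = jacW2 α β v := by
  ext i j
  fin_cases i <;> fin_cases j <;> rfl

theorem jacG_transpose : (jacG α β v)ᵀ = jacG α β v := by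
  ext i j
  fin_cases i <;> fin_cases j <;> rfl

theorem jacW_conjTranspose (x : ℝ) : (jacW α β v x)ᴴ = jacW α β v x := by
  rw [jacW, cmat_conjTranspose]
  congr 1
  ext i j
  fin_cases i <;> fin_cases j <;> simp [jacW2, jacW1, jacW0]

theorem jacDiag_conjTranspose (x : ℝ) : (jacDiag α β x)ᴴ = jacDiag α β x := by
  rw [jacDiag, cmat_conjTranspose, Matrix.transpose_smul, Matrix.transpose_one]

theorem jacDiag_mul (M : Matrix (Fin 2) (Fin 2) ℝ) (x : ℝ) :
    jacDiag α β x * cmat M = cmat (((1 - x) ^ (α + 1) * (1 + x) ^ (β + 1)) • M) := by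
  rw [jacDiag, ← cmat_mul, smul_mul_assoc, one_mul]

theorem jacobi_weight_succ {x : ℝ} (hx : x ∈ jacI) : (1 - x) ^ (α + 1) * (1 + x) ^ (β + 1) =
    (1 - x) ^ α * (1 + x) ^ β * (1 - x ^ 2) := by
  have h1 : 0 < 1 - x := by linarith [hx.2]
  have h2 : 0 < 1 + x := by linarith [hx.1]
  rw [Real.rpow_add_one h1.ne', Real.rpow_add_one h2.ne']
  ring

theorem hasDerivAt_jacobi_weight {x : ℝ} (hx : x ∈ jacI) :
    HasDerivAt (fun y : ℝ => (1 - y) ^ (α + 1) * (1 + y) ^ (β + 1))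
      ((1 - x) ^ α * (1 + x) ^ β * (β - α - x * (α + β + 2))) x := by
  have h1 : 0 < 1 - x := by linarith [hx.2]
  have h2 : 0 < 1 + x := by linarith [hx.1]
  have d1 : HasDerivAt (fun y : ℝ => (1 - y) ^ (α + 1)) (-1 * (α + 1) * (1 - x) ^ (α + 1 - 1)) x :=
    ((hasDerivAt_id x).const_sub 1).rpow_const (Or.inl h1.ne')
  have d2 : HasDerivAt (fun y : ℝ => (1 + y) ^ (β + 1)) (1 * (β + 1) * (1 + x) ^ (β + 1 - 1)) x :=
    ((hasDerivAt_id x).const_add 1).rpow_const (Or.inl h2.ne')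
  refine (d1.mul d2).congr_deriv ?_
  rw [add_sub_cancel_right, add_sub_cancel_right, Real.rpow_add_one h1.ne',
    Real.rpow_add_one h2.ne']
  ring

theorem neg_jacDiag_mul_symbol (x : ℝ) : -(jacDiag α β x *
    (evalAt ((-X + C (cmat (jacK α β v))) * C (cmat ((-1 / 4 : ℝ) • jacW2 α β v))) x)ᴴ) =
    cmat (((1 - x) ^ (α + 1) * (1 + x) ^ (β + 1)) • (x • ((-1 / 4 : ℝ) • jacW2 α β v) -
        ((-1 / 4 : ℝ) • jacW2 α β v) * (jacK α β v)ᵀ)) := by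
  rw [evalAt_mul, evalAt_neg_linear, evalAt_C, ← cmat_mul, cmat_conjTranspose, jacDiag_mul,
    ← cmat_neg, Matrix.transpose_mul, ← smul_neg]
  congr 2
  rw [Matrix.transpose_smul, jacW2_transpose, Matrix.transpose_add, Matrix.transpose_neg,
    Matrix.transpose_smul, Matrix.transpose_one, mul_add, mul_neg, mul_smul_comm, mul_one]
  abel

theorem jacDiag_mul_zeroth (x : ℝ) : jacDiag α β x *
    (evalAt (C (cmat (jacG α β v)) * C (cmat ((-1 / 4 : ℝ) • jacW2 α β v))) x)ᴴ =
    cmat (((1 - x) ^ (α + 1) * (1 + x) ^ (β + 1)) •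
      (((-1 / 4 : ℝ) • jacW2 α β v) * jacG α β v)) := by
  rw [evalAt_mul, evalAt_C, evalAt_C, ← cmat_mul, cmat_conjTranspose, jacDiag_mul,
    Matrix.transpose_mul, Matrix.transpose_smul, jacW2_transpose, jacG_transpose]

theorem symbol_mul_jacW (hv : |α - β| < |v|) (hv' : |v| < α + β + 2) {x : ℝ} (hx : x ∈ jacI) :
    evalAt (X + C (cmat (jacK α β v))) x * jacW α β v x = -(jacDiag α β x *
      (evalAt ((-X + C (cmat (jacK α β v))) * C (cmat ((-1 / 4 : ℝ) • jacW2 α β v))) x)ᴴ) := by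
  rw [neg_jacDiag_mul_symbol, evalAt_linear, jacW, ← cmat_mul, mul_smul_comm, jacobi_weight_succ hx,
    mul_smul _ (1 - x ^ 2), ← jac_symbol_mul_quad hv hv', jacQuad]

theorem matHasDerivAt_symbol (hv : |α - β| < |v|) (hv' : |v| < α + β + 2) {x : ℝ}
    (hx : x ∈ jacI) :
    MatHasDerivAt (fun y => -(jacDiag α β y *
      (evalAt ((-X + C (cmat (jacK α β v))) * C (cmat ((-1 / 4 : ℝ) • jacW2 α β v))) y)ᴴ))
      (evalAt (C (cmat (jacF α β v))) x * jacW α β v x - jacDiag α β x *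
        (evalAt (C (cmat (jacG α β v)) * C (cmat ((-1 / 4 : ℝ) • jacW2 α β v))) x)ᴴ) x := by
  have e : evalAt (C (cmat (jacF α β v))) x * jacW α β v x - jacDiag α β x *
        (evalAt (C (cmat (jacG α β v)) * C (cmat ((-1 / 4 : ℝ) • jacW2 α β v))) x)ᴴ =
      cmat (((1 - x) ^ α * (1 + x) ^ β * (β - α - x * (α + β + 2))) •
        (x • ((-1 / 4 : ℝ) • jacW2 α β v) - ((-1 / 4 : ℝ) • jacW2 α β v) * (jacK α β v)ᵀ) +
        ((1 - x) ^ (α + 1) * (1 + x) ^ (β + 1)) • ((-1 / 4 : ℝ) • jacW2 α β v)) := by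
    rw [evalAt_C, jacDiag_mul_zeroth, jacW, ← cmat_mul, ← cmat_sub, jacobi_weight_succ hx,
      mul_smul_comm, mul_smul _ (1 - x ^ 2), mul_smul _ (1 - x ^ 2), mul_smul _ (β - α - _),
      ← smul_add, ← smul_sub, jac_pearson hv hv', jacQuad]
  rw [e]
  simp only [neg_jacDiag_mul_symbol]
  intro i j
  have h1 : HasDerivAt (fun y : ℝ => y * ((-1 / 4 : ℝ) • jacW2 α β v) i j -
      (((-1 / 4 : ℝ) • jacW2 α β v) * (jacK α β v)ᵀ) i j)
      (1 * ((-1 / 4 : ℝ) • jacW2 α β v) i j) x :=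
    ((hasDerivAt_id x).mul_const _).sub_const _
  have h2 := ((hasDerivAt_jacobi_weight (α := α) (β := β) hx).mul h1).ofReal_comp
  rw [one_mul] at h2
  exact h2

theorem isFormalAdjoint_jacN (hv : |α - β| < |v|) (hv' : |v| < α + β + 2) :
    IsFormalAdjoint jacI (jacN α β v) (jacW α β v) (jacV α β v) (jacDiag α β) := by
  rw [jacN_eq, jacV_eq]
  have h₁ : ∀ x ∈ jacI,
      evalAt ((-X + C (cmat (jacK α β v))) * C (cmat ((-1 / 4 : ℝ) • jacW2 α β v))) x *
        jacDiag α β x = -(jacW α β v x * (evalAt (X + C (cmat (jacK α β v))) x)ᴴ) := by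
    intro x hx
    have h := congrArg Matrix.conjTranspose (symbol_mul_jacW hv hv' hx)
    rw [Matrix.conjTranspose_mul, Matrix.conjTranspose_neg, Matrix.conjTranspose_mul,
      Matrix.conjTranspose_conjTranspose, jacW_conjTranspose, jacDiag_conjTranspose] at h
    rw [h, neg_neg]
  refine isFormalAdjoint_first_order (fun x hx => ?_) h₁ fun x hx => ?_
  · refine cmat_isUnit ?_
    have h1 : 0 < (1 - x) ^ (α + 1) := Real.rpow_pos_of_pos (by linarith [hx.2]) _
    have h2 : 0 < (1 + x) ^ (β + 1) := Real.rpow_pos_of_pos (by linarith [hx.1]) _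
    rw [Matrix.det_smul, Matrix.det_one]
    positivity
  · intro i j
    have h := (matHasDerivAt_symbol hv hv' hx).conjTranspose i j
    have e : ∀ P : MatPoly 2, (jacDiag α β x * (evalAt P x)ᴴ)ᴴ = evalAt P x * jacDiag α β x := by
      intro P
      rw [Matrix.conjTranspose_mul, Matrix.conjTranspose_conjTranspose, jacDiag_conjTranspose]
    rw [Matrix.conjTranspose_sub, Matrix.conjTranspose_mul, jacW_conjTranspose, e] at h
    refine h.congr_of_eventuallyEq ?_
    -- The two functions agree only inside `(-1, 1)`, which is enough for the derivative at an
    -- interior point.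
    filter_upwards [isOpen_Ioo.mem_nhds hx] with y hy
    rw [← symbol_mul_jacW hv hv' hy, Matrix.conjTranspose_mul, jacW_conjTranspose]

theorem form_act_jacV (hv : |α - β| < |v|) (hv' : |v| < α + β + 2) (P Q : MatPoly 2) :
    form jacI (jacW α β v) (act P (jacV α β v)) Q =
      form jacI (jacDiag α β) P (act Q (jacN α β v)) := by
  obtain ⟨ha, hb, -⟩ := jac_bounds hv hv'
  have ha' : 0 < α + 1 := by linarith
  have hb' : 0 < β + 1 := by linarith
  rw [jacV_eq, jacN_eq, act_first_order, act_first_order]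
  refine form_act_eq_of_matHasDerivAt (by norm_num) (isWeight_jacW hv hv')
    (isWeight_jacDiag ha hb) (fun i j => ?_) ?_ ?_ (fun x hx => symbol_mul_jacW hv hv' hx)
    (fun x hx => matHasDerivAt_symbol hv hv' hx) P Q
  · refine (Complex.continuous_ofReal.comp (Continuous.mul (Continuous.mul ?_ ?_)
      continuous_const)).continuousOn
    · exact Continuous.rpow_const (by fun_prop) fun _ => Or.inr ha'.le
    · exact Continuous.rpow_const (by fun_prop) fun _ => Or.inr hb'.le
  · ext i j
    simp [jacDiag, cmat, Real.zero_rpow hb'.ne']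
  · ext i j
    simp [jacDiag, cmat, Real.zero_rpow ha'.ne']

/-! ### Jacobi polynomials as eigenfunctions of a triangular operator. -/

/-- A linear operator on polynomials that is triangular with distinct diagonal entries has a monic
eigenpolynomial of each degree. -/
theorem exists_monic_eigenpolynomial {K : Type*} [Field K] (T : K[X] →ₗ[K] K[X]) {c : ℕ → K}
    (hc : Function.Injective c) (hT : ∀ n, T (X ^ n) - c n • X ^ n ∈ degreeLT K n) (n : ℕ) :
    ∃ p : K[X], p.natDegree = n ∧ p.Monic ∧ T p = c n • p := by
  -- Below degree `n`, `T - c n` is triangular with nonzero diagonal entries `c k - c n`, hence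
  -- surjective; back substitution removes the top coefficient first.
  have solve : ∀ m ≤ n, ∀ r ∈ degreeLT K m, ∃ q ∈ degreeLT K m, T q - c n • q = r := by
    intro m
    induction m with
    | zero =>
      intro _ r hr
      refine ⟨0, zero_mem _, ?_⟩
      rw [mem_degreeLT, Nat.cast_zero, Nat.WithBot.lt_zero_iff, degree_eq_bot] at hr
      simp [hr]
    | succ m ih =>
      intro hm r hr
      have hne : c m - c n ≠ 0 := sub_ne_zero.2 fun h => by
        have := hc h
        omega
      set d := r.coeff m / (c m - c n) with hd
      have hdm : d * (c m - c n) = r.coeff m := div_mul_cancel₀ _ hne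
      have hmono : degreeLT K m ≤ degreeLT K (m + 1) := degreeLT_mono (Nat.le_succ m)
      have hX : (X ^ m : K[X]) ∈ degreeLT K (m + 1) := by
        rw [mem_degreeLT, degree_X_pow]
        exact_mod_cast Nat.lt_succ_self m
      have hr' : r - r.coeff m • X ^ m ∈ degreeLT K m := by
        rw [mem_degreeLT, degree_lt_iff_coeff_zero]
        intro k hk
        rw [coeff_sub, coeff_smul, coeff_X_pow]
        rcases hk.eq_or_lt with rfl | hlt
        · simp
        · rw [mem_degreeLT, degree_lt_iff_coeff_zero] at hr
          simp [hr k hlt, hlt.ne']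
      obtain ⟨q, hq, hqr⟩ := ih (by omega) _
        (sub_mem hr' (Submodule.smul_mem _ d (hT m)))
      refine ⟨q + d • X ^ m, add_mem (hmono hq) (Submodule.smul_mem _ d hX), ?_⟩
      have e : T (q + d • X ^ m) - c n • (q + d • X ^ m) = (T q - c n • q) +
          d • (T (X ^ m) - c m • X ^ m) + (d * (c m - c n)) • X ^ m := by
        rw [map_add, map_smul]
        module
      rw [e, hqr, hdm]
      abel
  -- The correction `q` cancels the defect of `X ^ n`, so the eigenpolynomial is `X ^ n + q`.
  obtain ⟨q, hq, hqr⟩ := solve n le_rfl _ (neg_mem (hT n))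
  rw [mem_degreeLT] at hq
  refine ⟨X ^ n + q, natDegree_eq_of_degree_eq_some ?_, monic_X_pow_add hq, ?_⟩
  · rw [degree_add_eq_left_of_degree_lt (by rwa [degree_X_pow]), degree_X_pow]
  · rw [← sub_eq_zero, map_add, smul_add]
    linear_combination hqr

noncomputable section

variable (α β v)

/-- The scalar Jacobi operator with parameters `α + 1` and `β + 1`. -/
def jacobiOp : ℂ[X] →ₗ[ℂ] ℂ[X] :=
  LinearMap.mulLeft ℂ (1 - X ^ 2) ∘ₗ derivative ∘ₗ derivative +
    LinearMap.mulLeft ℂ (C ((β - α : ℝ) : ℂ) - C ((α + β + 4 : ℝ) : ℂ) * X) ∘ₗ derivative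

/-- The eigenvalues of the Jacobi operator. -/
def jacobiEigenvalue (n : ℕ) : ℝ := -(n * (n + α + β + 3))

variable {α β v}

theorem jacobiEigenvalue_injective (ha : -1 < α) (hb : -1 < β) :
    Function.Injective (jacobiEigenvalue α β) := by
  intro m n h
  have h' : ((m : ℝ) - n) * (m + n + α + β + 3) = 0 := by
    simp only [jacobiEigenvalue] at h
    linear_combination -h
  have hm : (0 : ℝ) ≤ m := m.cast_nonneg
  have hn : (0 : ℝ) ≤ n := n.cast_nonneg
  rcases mul_eq_zero.1 h' with h' | h'
  · exact_mod_cast sub_eq_zero.1 h'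
  · linarith

theorem jacobiOp_X_pow (n : ℕ) : jacobiOp α β (X ^ n) -
    ((jacobiEigenvalue α β n : ℝ) : ℂ) • X ^ n ∈ degreeLT ℂ n := by
  have key : ∀ k < n, ∀ a : ℂ, C a * X ^ k ∈ degreeLT ℂ n := fun k hk a =>
    mem_degreeLT.2 ((degree_C_mul_X_pow_le k a).trans_lt (by exact_mod_cast hk))
  have e2 : (C 2 : ℂ[X]) = 2 := map_ofNat C 2
  have e3 : (C 3 : ℂ[X]) = 3 := map_ofNat C 3
  have e4 : (C 4 : ℂ[X]) = 4 := map_ofNat C 4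
  match n with
  | 0 => simp [jacobiOp, jacobiEigenvalue]
  | 1 =>
    convert key 0 one_pos ((β - α : ℝ) : ℂ) using 1
    simp [jacobiOp, jacobiEigenvalue, smul_eq_C_mul, e3, e4]
    ring
  | n + 2 =>
    convert add_mem (key n (by omega) ((n + 2) * (n + 1)))
      (key (n + 1) (by omega) (((β - α : ℝ) : ℂ) * (n + 2))) using 1
    simp [jacobiOp, jacobiEigenvalue, smul_eq_C_mul, e2, e3, e4]
    ring

theorem exists_jacobi_polynomial (ha : -1 < α) (hb : -1 < β) (n : ℕ) :
    ∃ p : ℂ[X], p.natDegree = n ∧ p.Monic ∧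
      jacobiOp α β p = ((jacobiEigenvalue α β n : ℝ) : ℂ) • p :=
  exists_monic_eigenpolynomial _
    (Complex.ofReal_injective.comp (jacobiEigenvalue_injective ha hb)) jacobiOp_X_pow n

/-! ### Orthogonality for both weights. -/

/-- A scalar polynomial, seen as a matrix polynomial. -/
def scalarPoly (p : ℂ[X]) : MatPoly 2 := p.map (algebraMap ℂ (CMat 2))

/-- Operators put constants on the right, eigenvalues stand on the left; scalar polynomials let them
cross. -/
theorem scalarPoly_mul_C (p : ℂ[X]) (A : CMat 2) :
    scalarPoly p * C A = C A * scalarPoly p := by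
  ext1 n
  rw [scalarPoly, coeff_mul_C, coeff_C_mul, coeff_map]
  exact Algebra.commutes _ _

theorem scalarPoly_C_ofReal (c : ℝ) : scalarPoly (C (c : ℂ)) = C (cmat (c • 1)) := by
  rw [scalarPoly, Polynomial.map_C, cmat_smul, cmat_one, Algebra.algebraMap_eq_smul_one]

theorem act_scalarPoly_jacD0 {p : ℂ[X]} {c : ℝ} (hp : jacobiOp α β p = (c : ℂ) • p) :
    act (scalarPoly p) (jacD0 α β v) =
      C (cmat (c • 1 + jacF α β v * jacG α β v)) * scalarPoly p := by
  have hd : derivative (scalarPoly p) = scalarPoly (derivative p) := derivative_map _ _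
  have hd2 : derivative (scalarPoly (derivative p)) = scalarPoly (derivative (derivative p)) :=
    derivative_map _ _
  have h2 : (1 - X ^ 2 : MatPoly 2) = scalarPoly (1 - X ^ 2) := by
    simp [scalarPoly]
  have h1 : (C (cmat ((β - α) • 1)) - C (cmat ((α + β + 4) • 1)) * X : MatPoly 2) =
      scalarPoly (C ((β - α : ℝ) : ℂ) - C ((α + β + 4 : ℝ) : ℂ) * X) := by
    rw [← scalarPoly_C_ofReal, ← scalarPoly_C_ofReal]
    simp [scalarPoly]
  have hT : scalarPoly (derivative (derivative p)) * scalarPoly (1 - X ^ 2) +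
      scalarPoly (derivative p) *
        scalarPoly (C ((β - α : ℝ) : ℂ) - C ((α + β + 4 : ℝ) : ℂ) * X) =
      C (cmat (c • 1)) * scalarPoly p := by
    rw [← scalarPoly_C_ofReal]
    simp only [scalarPoly, ← Polynomial.map_mul, ← Polynomial.map_add]
    congr 1
    rw [← smul_eq_C_mul (c : ℂ), ← hp]
    simp [jacobiOp]
    ring
  rw [jacD0, act_add, act_add, act_single, act_single, act_single, ← jacF_mul_jacG, h1, h2]
  simp only [Function.iterate_succ, Function.iterate_zero, Function.comp, id, hd, hd2]
  rw [hT, scalarPoly_mul_C, cmat_add, C_add, add_mul]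

theorem act_jacD (P : MatPoly 2) : act P (jacD α β v) =
    act P (jacD0 α β v) * C (cmat ((-1 / 4 : ℝ) • jacW2 α β v)) := by
  rw [jacD, act_opComp, jacS, act_single]
  rfl

theorem act_scalarPoly_jacD {p : ℂ[X]} {c : ℝ} (hp : jacobiOp α β p = (c : ℂ) • p) :
    act (scalarPoly p) (jacD α β v) =
      C (cmat ((c • 1 + jacF α β v * jacG α β v) * ((-1 / 4 : ℝ) • jacW2 α β v))) *
        scalarPoly p := by
  rw [act_jacD, act_scalarPoly_jacD0 hp, mul_assoc, scalarPoly_mul_C, ← mul_assoc, ← C_mul,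
    ← cmat_mul]

/-- Being a scalar matrix, the form is determined by one number, so a single matrix entry suffices
to show that it vanishes. -/
theorem form_scalarPoly (p q : ℂ[X]) :
    ∃ z : ℂ, form jacI (jacDiag α β) (scalarPoly p) (scalarPoly q) = z • 1 := by
  refine ⟨∫ x : ℝ in jacI, p.eval (x : ℂ) *
    ((((1 - x) ^ (α + 1) * (1 + x) ^ (β + 1) : ℝ) : ℂ) * star (q.eval (x : ℂ))), ?_⟩
  have h : ∀ x : ℝ, evalAt (scalarPoly p) x * jacDiag α β x * (evalAt (scalarPoly q) x)ᴴ =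
      (p.eval (x : ℂ) * ((((1 - x) ^ (α + 1) * (1 + x) ^ (β + 1) : ℝ) : ℂ) *
        star (q.eval (x : ℂ)))) • 1 := by
    intro x
    rw [scalarPoly, scalarPoly, evalAt_map, evalAt_map, jacDiag, cmat_smul, cmat_one,
      Matrix.conjTranspose_smul, Matrix.conjTranspose_one]
    simp only [smul_smul, mul_one, mul_smul_comm]
    congr 1
    ring
  ext i j
  simp only [form, Matrix.of_apply, h, Matrix.smul_apply, smul_eq_mul]
  exact integral_mul_const _ _

/-- Both sides equal `⟨P·𝒱, Q·𝒱⟩_W`. -/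
theorem form_act_jacD (hv : |α - β| < |v|) (hv' : |v| < α + β + 2) (P Q : MatPoly 2) :
    form jacI (jacDiag α β) (act P (jacD α β v)) Q =
      form jacI (jacDiag α β) P (act Q (jacD α β v)) := by
  obtain ⟨ha, hb, h0, -⟩ := jac_bounds hv hv'
  rw [jacD_eq_opComp h0, act_opComp, act_opComp, ← form_act_jacV hv hv',
    ← (isWeight_jacDiag ha hb).form_conjTranspose, ← form_act_jacV hv hv',
    (isWeight_jacW hv hv').form_conjTranspose]

theorem form_scalarPoly_eq_zero (hv : |α - β| < |v|) (hv' : |v| < α + β + 2) {p q : ℂ[X]}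
    {c d : ℝ} (hp : jacobiOp α β p = (c : ℂ) • p) (hq : jacobiOp α β q = (d : ℂ) • q)
    (hcd : c ≠ d) : form jacI (jacDiag α β) (scalarPoly p) (scalarPoly q) = 0 := by
  obtain ⟨ha, hb, -⟩ := jac_bounds hv hv'
  obtain ⟨z, hz⟩ := form_scalarPoly (α := α) (β := β) p q
  have h := form_act_jacD hv hv' (scalarPoly p) (scalarPoly q)
  rw [act_scalarPoly_jacD hp, act_scalarPoly_jacD hq, (isWeight_jacDiag ha hb).form_C_mul_left,
    (isWeight_jacDiag ha hb).form_C_mul_right, hz, cmat_conjTranspose] at h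
  have hS : (jacW2 α β v 0 0 : ℂ) ≠ 0 :=
    Complex.ofReal_ne_zero.2 (jacW2_diag_pos hv hv').1.ne'
  have h00 := congrFun (congrFun h 0) 0
  -- The `(0, 0)` entry of the eigenvalue is affine in `t` with nonzero slope, so it separates `c`
  -- from `d`.
  have e : ∀ t : ℝ, ((t • 1 + jacF α β v * jacG α β v) * ((-1 / 4 : ℝ) • jacW2 α β v)) 0 0 =
      (t + jacF α β v 0 0 * jacG α β v 0 0) * (-1 / 4 * jacW2 α β v 0 0) := by
    intro t
    have h10 : jacW2 α β v 1 0 = 0 := rfl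
    have h01 : jacF α β v 0 1 = 0 := rfl
    simp [Matrix.mul_apply, Fin.sum_univ_two, h10, h01]
  rw [mul_smul_comm, mul_one, smul_mul_assoc, one_mul, Matrix.smul_apply, Matrix.smul_apply, cmat,
    cmat, Matrix.map_apply, Matrix.map_apply, Matrix.transpose_apply, e, e] at h00
  have hz0 : z * (((c - d : ℝ) : ℂ) * (jacW2 α β v 0 0 : ℂ)) = 0 := by
    push_cast [smul_eq_mul] at h00 ⊢
    linear_combination -4 * h00
  have hcd' : ((c - d : ℝ) : ℂ) ≠ 0 := Complex.ofReal_ne_zero.2 (sub_ne_zero.2 hcd)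
  rw [hz, (mul_eq_zero.1 hz0).resolve_right (mul_ne_zero hcd' hS), zero_smul]

/-- The monic orthogonal polynomials of the diagonal weight are scalar Jacobi polynomials, and `𝒱`
maps them to invertible multiples of the monic orthogonal polynomials of `W`. -/
theorem exists_isMonicOPS (hv : |α - β| < |v|) (hv' : |v| < α + β + 2) :
    ∃ p : ℕ → ℂ[X], (∀ n, jacobiOp α β (p n) = ((jacobiEigenvalue α β n : ℝ) : ℂ) • p n) ∧
      IsMonicOPS jacI (jacDiag α β) (fun n => scalarPoly (p n)) ∧
      ∃ P' : ℕ → MatPoly 2, IsMonicOPS jacI (jacW α β v) P' ∧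
        ∀ n, ∃ A : CMat 2, IsUnit A ∧ act (scalarPoly (p n)) (jacV α β v) = C A * P' n := by
  obtain ⟨ha, hb, h0, -⟩ := jac_bounds hv hv'
  choose p hdeg hmonic hp using exists_jacobi_polynomial ha hb
  have hP : ∀ n, (scalarPoly (p n)).natDegree = n ∧ (scalarPoly (p n)).Monic := fun n =>
    ⟨((hmonic n).natDegree_map _).trans (hdeg n), (hmonic n).map _⟩
  have horth : ∀ n m, n ≠ m →
      form jacI (jacDiag α β) (scalarPoly (p n)) (scalarPoly (p m)) = 0 := fun n m hnm =>
    form_scalarPoly_eq_zero hv hv' (hp n) (hp m) fun h => hnm (jacobiEigenvalue_injective ha hb h)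
  set A : ℕ → CMat 2 := fun n => cmat ((n : ℝ) • 1 + jacF α β v) with hA
  have hAu : ∀ n, IsUnit (A n).det := fun n =>
    (Matrix.isUnit_iff_isUnit_det _).1 (jacV_symbol_isUnit hv' n)
  refine ⟨p, hp, ⟨hP, horth⟩, fun n => C (A n)⁻¹ * act (scalarPoly (p n)) (jacV α β v),
    ⟨fun n => ?_, fun n m hnm => ?_⟩, fun n => ⟨A n, jacV_symbol_isUnit hv' n, ?_⟩⟩
  · have hle : (C (A n)⁻¹ * act (scalarPoly (p n)) (jacV α β v)).natDegree ≤ n := by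
      refine (natDegree_C_mul_le _ _).trans ?_
      rw [natDegree_eq_of_degree_eq (degreePreserving_jacV hv' _), (hP n).1]
    have hcoeff : (C (A n)⁻¹ * act (scalarPoly (p n)) (jacV α β v)).coeff n = 1 := by
      have h1 : (scalarPoly (p n)).coeff n = 1 := by
        have := (hP n).2.coeff_natDegree
        rwa [(hP n).1] at this
      have h2 : (scalarPoly (p n)).coeff (n + 1) = 0 :=
        coeff_eq_zero_of_natDegree_lt (by rw [(hP n).1]; omega)
      rw [coeff_C_mul, coeff_act_jacV, h1, h2, one_mul, zero_mul, add_zero]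
      exact Matrix.nonsing_inv_mul _ (hAu n)
    exact ⟨natDegree_eq_of_le_of_coeff_ne_zero hle (by rw [hcoeff]; exact one_ne_zero),
      monic_of_natDegree_le_of_coeff_eq_one n hle hcoeff⟩
  · have hW := isWeight_jacW hv hv'
    -- Moving `𝒱` across the form turns the second argument into `Pₘ·𝒱𝒩 = Pₘ·D`, a left multiple of
    -- `Pₘ`.
    have hD : act (act (scalarPoly (p m)) (jacV α β v)) (jacN α β v) = _ :=
      (act_opComp _ _ _).symm.trans ((congrArg (act _) (jacD_eq_opComp h0).symm).trans
        (act_scalarPoly_jacD (hp m)))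
    rw [hW.form_C_mul_left, hW.form_C_mul_right, form_act_jacV hv hv', hD,
      (isWeight_jacDiag ha hb).form_C_mul_right, horth n m hnm]
    simp
  · rw [← mul_assoc, ← C_mul, Matrix.mul_nonsing_inv _ (hAu n), C_1, one_mul]

end

end MatrixDarboux

theorem theorem7p1 (α β v : ℝ) (hv : |α - β| < |v|) (hv' : |v| < α + β + 2) :
    -- both functions are weight matrices on `(-1, 1)`, and `W` is irreducible
    IsWeight jacI (jacW α β v) ∧ IsWeight jacI (jacDiag α β) ∧
    ¬ IsReducible jacI (jacW α β v) ∧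
    -- `W` is a Darboux transformation of the diagonal weight
    IsDarbouxTransform jacI (jacW α β v) (jacDiag α β) ∧
    -- the explicit factorization that exhibits it
    (MemAlg jacI (jacDiag α β) (jacD0 α β v) ∧ jacD0 α β v = opComp (jacV α β v) (jacN0 α β v)) ∧
    (MemAlg jacI (jacDiag α β) (jacD α β v) ∧ jacD α β v = opComp (jacV α β v) (jacN α β v)) ∧
    IsFormalAdjoint jacI (jacN α β v) (jacW α β v) (jacV α β v) (jacDiag α β) ∧
    DegreePreserving (jacV α β v) ∧ DegreePreserving (jacN0 α β v) ∧
    DegreePreserving (jacN α β v) ∧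
    (∀ P Q : MatPoly 2, form jacI (jacW α β v) (act P (jacV α β v)) Q =
      form jacI (jacDiag α β) P (act Q (jacN α β v))) ∧
    (∃ P P' : ℕ → MatPoly 2, IsMonicOPS jacI (jacDiag α β) P ∧ IsMonicOPS jacI (jacW α β v) P' ∧
      ∀ n, ∃ A : CMat 2, IsUnit A ∧ act (P n) (jacV α β v) = C A * P' n) := by
  obtain ⟨ha, hb, h0, -⟩ := jac_bounds hv hv'
  obtain ⟨p, hp, hP, P', hP', hA⟩ := exists_isMonicOPS hv hv'
  have hD : MemAlg jacI (jacDiag α β) (jacD α β v) :=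
    ⟨_, hP, fun n => ⟨_, act_scalarPoly_jacD (hp n)⟩⟩
  exact ⟨isWeight_jacW hv hv', isWeight_jacDiag ha hb, not_isReducible_jacW hv hv',
    ⟨_, P', hP, hP', _, _, _, hD, jacD_eq_opComp h0, degreePreserving_jacV hv',
      degreePreserving_jacN hv hv', fun n => (hA n).imp fun _ h => h.2⟩,
    ⟨⟨_, hP, fun n => ⟨_, act_scalarPoly_jacD0 (hp n)⟩⟩, jacD0_eq_opComp h0⟩,
    ⟨hD, jacD_eq_opComp h0⟩, isFormalAdjoint_jacN hv hv', degreePreserving_jacV hv',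
    degreePreserving_jacN0 hv', degreePreserving_jacN hv hv', form_act_jacV hv hv',
    _, P', hP, hP', hA⟩
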